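/- For a finite-dimensional complex Hilbert space $\mathscr{H}$ let $\mathbb{S}(\mathscr{H})$ be its unit sphere. For a density matrix $\rho=\sum_n p_n|n\rangle\langle n|$ on $\mathscr{H}$ (with $\{|n\rangle\}$ an orthonormal eigenbasis of $\rho$) let $G(\rho)$ be the distribution of $\sum_n Z_n|n\rangle$, where the $Z_n$ are independent complex random variables whose real and imaginary parts are independent, centred Gaussian with variance $p_n/2$. Let $GA(\rho)(d\psi)=\|\psi\|^2\,G(\rho)(d\psi)$, and let $GAP(\rho)$, a probability measure on $\mathbb{S}(\mathscr{H})$, be the image of $GA(\rho)$ under the normalization $\psi\mapsto\psi/\|\psi\|$ (defined for $\psi\neq0$). Let $\mathscr{H}_1,\mathscr{H}_2$ be finite-dimensional complex Hilbert spaces and let $\psi\in\mathscr{H}_1\otimes\mathscr{H}_2$ with $\|\psi\|=1$. Write $\rho_1^\psi=\mathrm{tr}_2|\psi\rangle\langle\psi|$ for the reduced density matrix on $\mathscr{H}_1$. For an orthonormal basis $b=\{|q_2\rangle\}$ of $\mathscr{H}_2$ let $\langle q_2|\psi\rangle\in\mathscr{H}_1$ be the partial scalar product and let $\mu_1^{\psi,b}$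 be the distribution on $\mathbb{S}(\mathscr{H}_1)$ of the conditional wave function $\Psi_1=\langle Q_2|\psi\rangle/\|\langle Q_2|\psi\rangle\|$, where $|Q_2\rangle$ is a random element of $b$ with $\mathbb{P}(Q_2=q_2)=\|\langle q_2|\psi\rangle\|^2$. Let $\nu_{\mathscr{H}_2}$ be the uniform distribution on the set $ONB(\mathscr{H}_2)$ of orthonormal bases of $\mathscr{H}_2$, that is, the image of the normalized Haar measure on the unitary group of $\mathscr{H}_2$ under $U\mapsto Ub_0$ for a fixed orthonormal basis $b_0$. For a measure $\mu$ on $\mathbb{S}(\mathscr{H}_1)$ write $\mu(f)=\int f\,d\mu$. **Corollary.** Let $\mathscr{H}_1$ be a finite-dimensional complex Hilbert space. For every $\varepsilon>0$ and every bounded continuous function $f:\mathbb{S}(\mathscr{H}_1)\to\mathbb{R}$, $$\nu_{\mathscr{H}_2}\Bigl\{b\in ONB(\mathscr{H}_2):\ \bigl|\mu_1^{\psi,b}(f)-GAP(\rho_1^\psi)(f)\bigr|<\varepsilon\Bigr\}\longrightarrow 1\qquad\text{as }\dim\mathscr{H}_2\to\infty,$$ whatever the unit vectors $\psi\in\mathscr{H}_1\otimes\mathscr{H}_2$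 are. Explicitly: for all such $\varepsilon$ and $f$ and every $\delta>0$ there is an $M\in\mathbb{N}$ such that for every finite-dimensional complex Hilbert space $\mathscr{H}_2$ with $\dim\mathscr{H}_2\ge M$ and every $\psi\in\mathscr{H}_1\otimes\mathscr{H}_2$ with $\|\psi\|=1$, the measure on the left is greater than $1-\delta$. -/

import Mathlib

universe u v

open MeasureTheory ProbabilityTheory Module
open scoped TensorProduct InnerProductSpace

noncomputable section

namespace GAPTypicality

section Bases

variable {ι H : Type*} [Fintype ι] [NormedAddCommGroup H] [InnerProductSpace ℂ H]

/-- The set of (labelled) orthonormal bases carries the topology of pointwise convergence, that is,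
the topology it has as a subset of `ι → H`. -/
instance instTopologicalSpaceONB : TopologicalSpace (OrthonormalBasis ι ℂ H) :=
  TopologicalSpace.induced (fun b (i : ι) => b i) inferInstance

/-- The Borel σ-algebra on the set of orthonormal bases. -/
instance instMeasurableSpaceONB : MeasurableSpace (OrthonormalBasis ι ℂ H) := borel _

instance instBorelSpaceONB : BorelSpace (OrthonormalBasis ι ℂ H) := ⟨rfl⟩

end Bases

section HaarMeasure

/-- The action of the unitary group on a fixed orthonormal basis is measurable. -/
lemma measurable_map_onb {ι H : Type*} [Fintype ι] [NormedAddCommGroup H] [InnerProductSpace ℂ H]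
    [CompleteSpace H] (b : OrthonormalBasis ι ℂ H) :
    Measurable fun U : unitary (H →L[ℂ] H) => b.map (Unitary.linearIsometryEquiv U) := by
  refine Continuous.measurable (continuous_induced_rng.mpr (continuous_pi fun i => ?_))
  change Continuous fun U : unitary (H →L[ℂ] H) => (U : H →L[ℂ] H) (b i)
  fun_prop

variable (H : Type*) [NormedAddCommGroup H] [InnerProductSpace ℂ H] [FiniteDimensional ℂ H]
  [CompleteSpace H]

/-- The unitary group of a finite-dimensional Hilbert space is compact (in the operator norm). -/
instance instCompactSpaceUnitary : CompactSpace (unitary (H →L[ℂ] H)) := by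
  have : ProperSpace (H →L[ℂ] H) := FiniteDimensional.proper ℂ _
  refine isCompact_iff_compactSpace.mp (Metric.isCompact_of_isClosed_isBounded ?_ ?_)
  · exact isClosed_unitary
  · refine (Metric.isBounded_closedBall (x := (0 : H →L[ℂ] H)) (r := 1)).subset fun U hU => ?_
    rw [mem_closedBall_zero_iff]
    refine ContinuousLinearMap.opNorm_le_bound _ zero_le_one fun x => ?_
    have h := (Unitary.linearIsometryEquiv ⟨U, hU⟩).norm_map x
    rw [one_mul]
    exact le_of_eq h

/-- The normalized Haar measure of the unitary group of `H`. -/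
def haarUnitary : Measure (unitary (H →L[ℂ] H)) :=
  Measure.haarMeasure (⊤ : TopologicalSpace.PositiveCompacts (unitary (H →L[ℂ] H)))

instance : IsProbabilityMeasure (haarUnitary H) :=
  ⟨Measure.haarMeasure_self (K₀ := ⊤)⟩

/-- The uniform distribution on the set of all orthonormal bases of `H`: the law of
`U b₀` for a Haar-distributed unitary `U` and a fixed orthonormal basis `b₀`. -/
def uniformONB : Measure (OrthonormalBasis (Fin (finrank ℂ H)) ℂ H) :=
  (haarUnitary H).map fun U => (stdOrthonormalBasis ℂ H).map (Unitary.linearIsometryEquiv U)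

instance : IsProbabilityMeasure (uniformONB H) :=
  Measure.isProbabilityMeasure_map (measurable_map_onb _).aemeasurable

end HaarMeasure

section GaussianAdjustedProjected

variable {H : Type*} [NormedAddCommGroup H] [InnerProductSpace ℂ H]

/-- The projection `P ψ = ‖ψ‖⁻¹ ψ` of nonzero vectors to the unit sphere. -/
def proj (ψ : {ψ : H // ψ ≠ 0}) : Metric.sphere (0 : H) 1 :=
  ⟨((‖(ψ : H)‖⁻¹ : ℝ) : ℂ) • (ψ : H), by
    have h : ‖(ψ : H)‖ ≠ 0 := norm_ne_zero_iff.mpr ψ.2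
    simp [norm_smul, h]⟩

variable [MeasurableSpace H]

/-- The action `P_* μ` of the projection to the unit sphere on measures: first restrict `μ` to the
nonzero vectors, then push forward by `P`. -/
def projMeasure (μ : Measure H) : Measure (Metric.sphere (0 : H) 1) :=
  (μ.comap (Subtype.val : {ψ : H // ψ ≠ 0} → H)).map proj

/-- The rotationally symmetric complex Gaussian distribution with mean `0` and `𝔼 |Z|² = p`:
real and imaginary part are independent real Gaussians with mean `0` and variance `p / 2`. -/
def complexGaussian (p : ℝ) : Measure ℂ :=
  ((gaussianReal 0 (p / 2).toNNReal).prod (gaussianReal 0 (p / 2).toNNReal)).map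
    fun z => (z.1 : ℂ) + z.2 * Complex.I

variable [FiniteDimensional ℂ H]

/-- The Gaussian measure `G(ρ)` with mean `0` and covariance `ρ`: the law of `∑ n, Z n • e n`, where
`e` is an orthonormal basis of eigenvectors of `ρ`, with eigenvalues `p n`, and the `Z n` are
independent complex Gaussians with mean `0` and `𝔼 |Z n|² = p n`. -/
def gaussianMeasure (ρ : H →ₗ[ℂ] H) (hρ : ρ.IsPositive) : Measure H :=
  (Measure.pi fun n => complexGaussian (hρ.isSymmetric.eigenvalues rfl n)).map
    fun z => ∑ n, z n • hρ.isSymmetric.eigenvectorBasis rfl n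

/-- The adjusted Gaussian measure `GA(ρ)(dψ) = ‖ψ‖² G(ρ)(dψ)`. -/
def gaMeasure (ρ : H →ₗ[ℂ] H) (hρ : ρ.IsPositive) : Measure H :=
  (gaussianMeasure ρ hρ).withDensity fun ψ => ENNReal.ofReal (‖ψ‖ ^ 2)

/-- The Gaussian adjusted projected measure `GAP(ρ) = P_* GA(ρ)` on the unit sphere. -/
def gapMeasure (ρ : H →ₗ[ℂ] H) (hρ : ρ.IsPositive) : Measure (Metric.sphere (0 : H) 1) :=
  projMeasure (gaMeasure ρ hρ)

end GaussianAdjustedProjected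

section Composite

variable {H₁ H₂ : Type*} [NormedAddCommGroup H₁] [InnerProductSpace ℂ H₁]
  [NormedAddCommGroup H₂] [InnerProductSpace ℂ H₂]

/-- The partial scalar product `⟨q₂|ψ⟩ ∈ H₁`, taken in `H₂`: the linear map with
`⟨q₂| x ⊗ y⟩ = ⟨q₂|y⟩ x`. -/
def partialInner (q₂ : H₂) : H₁ ⊗[ℂ] H₂ →ₗ[ℂ] H₁ :=
  (TensorProduct.rid ℂ H₁).toLinearMap ∘ₗ LinearMap.lTensor H₁ (innerₛₗ ℂ q₂)

lemma partialInner_tmul (q₂ : H₂) (x : H₁) (y : H₂) :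
    partialInner q₂ (x ⊗ₜ[ℂ] y) = ⟪q₂, y⟫_ℂ • x := by
  simp [partialInner]

lemma inner_partialInner (q₂ : H₂) (x : H₁) (ψ : H₁ ⊗[ℂ] H₂) :
    ⟪x, partialInner q₂ ψ⟫_ℂ = ⟪x ⊗ₜ[ℂ] q₂, ψ⟫_ℂ := by
  induction ψ using TensorProduct.induction_on with
  | zero => simp
  | tmul a b => rw [partialInner_tmul, inner_smul_right, TensorProduct.inner_tmul, mul_comm]
  | add a b ha hb => rw [map_add, inner_add_right, inner_add_right, ha, hb]

/-- The partial trace `tr₂ A = ∑ q₂, ⟨q₂| A |q₂⟩`, an operator on `H₁`. The sum runs over an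
orthonormal basis of `H₂`; it does not depend on which. -/
def partialTrace [FiniteDimensional ℂ H₂] (A : H₁ ⊗[ℂ] H₂ →ₗ[ℂ] H₁ ⊗[ℂ] H₂) : H₁ →ₗ[ℂ] H₁ :=
  ∑ i, partialInner (stdOrthonormalBasis ℂ H₂ i) ∘ₗ A ∘ₗ
    (TensorProduct.mk ℂ H₁ H₂).flip (stdOrthonormalBasis ℂ H₂ i)

/-- The reduced density matrix `ρ₁ = tr₂ |ψ⟩⟨ψ|` of system 1. -/
def reducedDensity [FiniteDimensional ℂ H₂] (ψ : H₁ ⊗[ℂ] H₂) : H₁ →ₗ[ℂ] H₁ :=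
  partialTrace (InnerProductSpace.rankOne ℂ ψ ψ).toLinearMap

lemma reducedDensity_isPositive [FiniteDimensional ℂ H₂] (ψ : H₁ ⊗[ℂ] H₂) :
    (reducedDensity ψ).IsPositive := by
  refine LinearMap.isPositive_sum _ fun i _ => ?_
  have key : ∀ x y : H₁, ⟪x, (partialInner (stdOrthonormalBasis ℂ H₂ i) ∘ₗ
      (InnerProductSpace.rankOne ℂ ψ ψ).toLinearMap ∘ₗ
      (TensorProduct.mk ℂ H₁ H₂).flip (stdOrthonormalBasis ℂ H₂ i)) y⟫_ℂ =
      ⟪ψ, y ⊗ₜ[ℂ] stdOrthonormalBasis ℂ H₂ i⟫_ℂ *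
        ⟪x ⊗ₜ[ℂ] stdOrthonormalBasis ℂ H₂ i, ψ⟫_ℂ := by
    intro x y
    simp [inner_partialInner]
  refine ⟨fun x y => ?_, fun x => ?_⟩
  · rw [key, ← inner_conj_symm, key, map_mul, inner_conj_symm ψ, ← inner_conj_symm ψ, mul_comm]
    simp only [inner_conj_symm]
  · rw [← inner_conj_symm, key, ← inner_conj_symm ψ, RCLike.conj_re, mul_comm,
      RCLike.mul_conj]
    norm_cast
    positivity

/-- The quantum distribution `ℙ(Q₂ = q₂) = ‖⟨q₂|ψ⟩‖²` of the index of a random element of the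
orthonormal basis `b` of `H₂`. -/
def quantumDistribution {ι : Type*} [Fintype ι] [MeasurableSpace ι]
    (b : OrthonormalBasis ι ℂ H₂) (ψ : H₁ ⊗[ℂ] H₂) : Measure ι :=
  ∑ q, ENNReal.ofReal (‖partialInner (b q) ψ‖ ^ 2) • Measure.dirac q

/-- The distribution `μ₁^ψ` of the conditional wave function `Ψ₁ = ⟨Q₂|ψ⟩ / ‖⟨Q₂|ψ⟩‖`, where `Q₂`
has the quantum distribution. Basis vectors with `⟨q₂|ψ⟩ = 0` have probability zero. -/
def conditionalWaveLaw [MeasurableSpace H₁] {ι : Type*} [Fintype ι] [MeasurableSpace ι]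
    (b : OrthonormalBasis ι ℂ H₂) (ψ : H₁ ⊗[ℂ] H₂) : Measure (Metric.sphere (0 : H₁) 1) :=
  projMeasure ((quantumDistribution b ψ).map fun q => partialInner (b q) ψ)

end Composite

end GAPTypicality

end

namespace GAPTypicality

/-! ### Complex Gaussians: characteristic function, scaling, moments. -/

section ComplexGaussian

/-! Let `F = quadExtension f`, that is `F ψ = ‖ψ‖² f(ψ/‖ψ‖)`. The weights `‖⟨q₂|ψ⟩‖²` and the
density `‖ψ‖²` are absorbed into `F`: the conditional law integrates `f` to `∑ q, F ⟨b q|ψ⟩`, and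
`GAP(ρ)` to the mean of `F` under `G(ρ)`. By Schmidt, `⟨b q|ψ⟩ = ∑ i, ⟨b q, φ i⟩ √(p i) χ i` with
`φ` orthonormal. It remains to see that, for a random basis of a space of large dimension `n`, the
coefficients `⟨b q, φ i⟩` act like independent Gaussians divided by `√n`.

Take an `n × k` Gaussian array `z`, `k = dim H₁`. Its columns divided by `√n` are almost orthonormal
with high probability (`exists_gaussianArray_gram_le`), hence close to an orthonormal family `w`
(`exists_orthonormal_near`). The empirical mean of `F` over its rows is close to the Gaussian mean
(`gaussianArray_quadExtension_le`). Since the law of `z` is unitarily invariant, Fubini gives one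
array with both a good Gram matrix and good row means after most rotations
(`exists_rotatedArray_notMem`). Passing from the columns to `w` costs little
(`abs_sum_quadExtension_sub_le`), and left invariance of Haar measure replaces `w` by `φ`. The
bounds depend on `f` and `k` but not on `p` or `φ`, whence uniformity in `ψ`. -/

lemma measurable_ofReal_add_ofReal_mul_I :
    Measurable fun z : ℝ × ℝ => (z.1 : ℂ) + z.2 * Complex.I := by fun_prop

instance (p : ℝ) : IsProbabilityMeasure (complexGaussian p) :=
  Measure.isProbabilityMeasure_map measurable_ofReal_add_ofReal_mul_I.aemeasurable

lemma charFun_complexGaussian_one (t : ℂ) :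
    charFun (complexGaussian 1) t = Complex.exp (-(‖t‖ ^ 2 / 4 : ℝ)) := by
  have h (z : ℝ × ℝ) : Complex.exp (⟪(z.1 : ℂ) + z.2 * Complex.I, t⟫_ℝ * Complex.I) =
      Complex.exp (t.re * z.1 * Complex.I) * Complex.exp (t.im * z.2 * Complex.I) := by
    rw [← Complex.exp_add, Complex.inner]
    congr 1
    simp
    ring
  rw [charFun_apply, complexGaussian,
    integral_map measurable_ofReal_add_ofReal_mul_I.aemeasurable (by fun_prop)]
  simp_rw [h]
  rw [integral_prod_mul (fun x : ℝ => Complex.exp (t.re * x * Complex.I))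
    (fun x : ℝ => Complex.exp (t.im * x * Complex.I)), ← charFun_apply_real, ← charFun_apply_real,
    charFun_gaussianReal, charFun_gaussianReal, ← Complex.exp_add]
  congr 1
  rw [← Complex.normSq_eq_norm_sq, Complex.normSq_apply, Real.coe_toNNReal _ (by norm_num)]
  push_cast
  ring

lemma complexGaussian_map_const_mul {p : ℝ} (hp : 0 ≤ p) :
    (complexGaussian 1).map (fun z => (√p : ℂ) * z) = complexGaussian p := by
  have h : (gaussianReal 0 (1 / 2 : ℝ).toNNReal).map (√p * ·) =
      gaussianReal 0 (p / 2).toNNReal := by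
    rw [gaussianReal_map_const_mul]
    congr 1
    · simp
    · ext
      push_cast [Real.coe_toNNReal, hp, Real.coe_toNNReal (p / 2) (by positivity),
        Real.coe_toNNReal (1 / 2) (by positivity), Real.sq_sqrt hp]
      ring
  rw [complexGaussian, complexGaussian, ← h, Measure.map_prod_map _ _ (by fun_prop) (by fun_prop),
    Measure.map_map (by fun_prop) (by fun_prop), Measure.map_map (by fun_prop) (by fun_prop)]
  congr 1
  ext z
  simp
  ring

lemma memLp_complexGaussian (p : ℝ) (n : ℕ) : MemLp id n (complexGaussian p) := by
  have h : MemLp (fun z : ℝ × ℝ => (z.1 : ℂ) + z.2 * Complex.I) n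
      ((gaussianReal 0 (p / 2).toNNReal).prod (gaussianReal 0 (p / 2).toNNReal)) := by
    have h0 := (memLp_id_gaussianReal' (μ := 0) (v := (p / 2).toNNReal) n (by simp))
    have h1 := (h0.comp_fst (gaussianReal 0 (p / 2).toNNReal)).ofReal (K := ℂ)
    have h2 := (h0.comp_snd (gaussianReal 0 (p / 2).toNNReal)).ofReal (K := ℂ)
    exact h1.add (h2.mul_const Complex.I)
  exact (memLp_map_measure_iff (by fun_prop) measurable_ofReal_add_ofReal_mul_I.aemeasurable).2 h

lemma integral_complexGaussian : ∫ z, z ∂complexGaussian 1 = 0 := by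
  rw [complexGaussian, integral_map measurable_ofReal_add_ofReal_mul_I.aemeasurable (by fun_prop)]
  have h0 : Integrable (fun x : ℝ => (x : ℂ)) (gaussianReal 0 (1 / 2 : ℝ).toNNReal) :=
    ((memLp_id_gaussianReal (μ := 0) (v := (1 / 2 : ℝ).toNNReal) 1).integrable (by simp)).ofReal
  rw [integral_add (h0.comp_fst _) ((h0.comp_snd _).mul_const _), integral_mul_const,
    integral_complex_ofReal, integral_complex_ofReal,
    integral_fun_fst (fun x : ℝ => x), integral_fun_snd (fun x : ℝ => x)]
  simp

lemma integral_norm_sq_complexGaussian : ∫ z, ‖z‖ ^ 2 ∂complexGaussian 1 = 1 := by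
  rw [complexGaussian, integral_map measurable_ofReal_add_ofReal_mul_I.aemeasurable (by fun_prop)]
  have h (z : ℝ × ℝ) : ‖(z.1 : ℂ) + z.2 * Complex.I‖ ^ 2 = z.1 ^ 2 + z.2 ^ 2 := by
    rw [← Complex.normSq_eq_norm_sq, Complex.normSq_add_mul_I]
  simp_rw [h]
  have h0 := (memLp_id_gaussianReal (μ := 0) (v := (1 / 2 : ℝ).toNNReal) 2).integrable_sq
  simp only [id] at h0
  have h1 : ∫ x, x ^ 2 ∂(gaussianReal 0 (1 / 2 : ℝ).toNNReal) = 1 / 2 := by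
    have := variance_id_gaussianReal (μ := 0) (v := (1 / 2 : ℝ).toNNReal)
    rw [variance_of_integral_eq_zero (by fun_prop) (by simp)] at this
    simpa using this
  rw [integral_add (h0.comp_fst _) (h0.comp_snd _),
    integral_fun_fst (fun x : ℝ => x ^ 2), integral_fun_snd (fun x : ℝ => x ^ 2), h1]
  norm_num

end ComplexGaussian

/-! ### Gaussian matrices and their unitary invariance. -/

section GaussianArray

variable (ι κ : Type*) [Fintype ι] [Fintype κ]

/-- The law of a vector of independent standard complex Gaussians. -/
noncomputable def gaussianRow : Measure (κ → ℂ) := Measure.pi fun _ => complexGaussian 1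

/-- The law of a matrix of independent standard complex Gaussians. -/
noncomputable def gaussianArray : Measure (ι → κ → ℂ) := Measure.pi fun _ => gaussianRow κ

instance : IsProbabilityMeasure (gaussianRow κ) := by unfold gaussianRow; infer_instance

instance : IsProbabilityMeasure (gaussianArray ι κ) := by unfold gaussianArray; infer_instance

variable {ι κ}

/-- Independence factorizes the integral. The result depends on `c` only through its Hilbert–Schmidt
norm, the source of unitary invariance. -/
lemma integral_exp_gaussianArray (c : ι → κ → ℂ) :
    ∫ z, Complex.exp ((∑ q, ∑ i, ⟪z q i, c q i⟫_ℝ : ℝ) * Complex.I) ∂gaussianArray ι κ =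
      Complex.exp (-((∑ q, ∑ i, ‖c q i‖ ^ 2) / 4 : ℝ)) := by
  have h (z : ι → κ → ℂ) : Complex.exp ((∑ q, ∑ i, ⟪z q i, c q i⟫_ℝ : ℝ) * Complex.I) =
      ∏ q, ∏ i, Complex.exp (⟪z q i, c q i⟫_ℝ * Complex.I) := by
    simp_rw [← Complex.exp_sum, Complex.ofReal_sum, Finset.sum_mul]
  simp_rw [h]
  rw [gaussianArray, integral_fintype_prod_eq_prod
    (fun q (y : κ → ℂ) => ∏ i, Complex.exp (⟪y i, c q i⟫_ℝ * Complex.I))]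
  have h1 (q : ι) : ∫ y, ∏ i, Complex.exp (⟪y i, c q i⟫_ℝ * Complex.I) ∂gaussianRow κ =
      ∏ i, Complex.exp (-(‖c q i‖ ^ 2 / 4 : ℝ)) := by
    rw [gaussianRow, integral_fintype_prod_eq_prod
      (fun i (w : ℂ) => Complex.exp (⟪w, c q i⟫_ℝ * Complex.I))]
    exact Finset.prod_congr rfl fun i _ => charFun_complexGaussian_one _
  simp_rw [h1, ← Complex.exp_sum]
  congr 1
  push_cast
  simp_rw [Finset.sum_div, Finset.sum_neg_distrib]

/-- Function spaces carry the sup norm, so laws are compared by `charFunDual`; this turns its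
functionals into the pairing of `integral_exp_gaussianArray`. -/
lemma strongDual_eq_sum_inner [DecidableEq ι] [DecidableEq κ] (L : StrongDual ℝ (ι → κ → ℂ)) :
    ∃ c : ι → κ → ℂ, ∀ z, L z = ∑ q, ∑ i, ⟪z q i, c q i⟫_ℝ := by
  refine ⟨fun q i => ⟨L (Pi.single q (Pi.single i 1)), L (Pi.single q (Pi.single i Complex.I))⟩,
    fun z => ?_⟩
  have hz : z = ∑ q, ∑ i, ((z q i).re • (Pi.single q (Pi.single i 1) : ι → κ → ℂ) +
      (z q i).im • (Pi.single q (Pi.single i Complex.I) : ι → κ → ℂ)) := by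
    ext q i
    simp only [Finset.sum_apply, Pi.add_apply, Pi.smul_apply]
    rw [Finset.sum_eq_single q, Finset.sum_eq_single i]
    · simp
    · intro j _ hj
      simp [hj.symm]
    · simp
    · intro r _ hr
      simp [hr.symm]
    · simp
  conv_lhs => rw [hz]
  simp only [map_sum, map_add, map_smul, smul_eq_mul, Complex.inner]
  refine Finset.sum_congr rfl fun q _ => Finset.sum_congr rfl fun i _ => ?_
  simp
  ring

/-- In trace form a unitary factor moves across the pairing as its adjoint. -/
lemma sum_inner_eq_trace (z c : ι → κ → ℂ) :
    ∑ q, ∑ i, ⟪z q i, c q i⟫_ℝ = ((Matrix.of z).conjTranspose * Matrix.of c).trace.re := by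
  rw [Finset.sum_comm]
  simp [Matrix.trace, Matrix.mul_apply, Complex.inner, mul_comm]

/-- The Gaussian array is invariant under multiplication by unitary matrices. -/
lemma gaussianArray_map_unitary [DecidableEq ι] (u : Matrix ι ι ℂ) (hu : u ∈ Matrix.unitaryGroup ι ℂ) :
    (gaussianArray ι κ).map (fun z q i => ∑ r, u q r * z r i) = gaussianArray ι κ := by
  classical
  have hm : Measurable fun (z : ι → κ → ℂ) q i => ∑ r, u q r * z r i := by fun_prop
  have := Measure.isProbabilityMeasure_map (μ := gaussianArray ι κ) hm.aemeasurable
  refine Measure.ext_of_charFunDual (funext fun L => ?_)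
  obtain ⟨c, hc⟩ := strongDual_eq_sum_inner L
  rw [charFunDual_apply, charFunDual_apply, integral_map hm.aemeasurable (by fun_prop)]
  simp_rw [hc]
  let c' : ι → κ → ℂ := fun q i => (u.conjTranspose * Matrix.of c) q i
  have hc' : Matrix.of c' = u.conjTranspose * Matrix.of c := rfl
  have h1 (z : ι → κ → ℂ) : ∑ q, ∑ i, ⟪∑ r, u q r * z r i, c q i⟫_ℝ =
      ∑ q, ∑ i, ⟪z q i, c' q i⟫_ℝ := by
    have hz : Matrix.of (fun q i => ∑ r, u q r * z r i) = u * Matrix.of z := rfl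
    rw [sum_inner_eq_trace (fun q i => ∑ r, u q r * z r i) c, hz, sum_inner_eq_trace, hc',
      Matrix.conjTranspose_mul, Matrix.mul_assoc]
  have h2 : ∑ q, ∑ i, ‖c' q i‖ ^ 2 = ∑ q, ∑ i, ‖c q i‖ ^ 2 := by
    simp_rw [← real_inner_self_eq_norm_sq]
    rw [sum_inner_eq_trace, sum_inner_eq_trace, hc', Matrix.conjTranspose_mul,
      Matrix.conjTranspose_conjTranspose, Matrix.mul_assoc, ← Matrix.mul_assoc u]
    have : u * u.conjTranspose = 1 := Matrix.mem_unitaryGroup_iff.1 hu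
    rw [this, Matrix.one_mul]
  simp_rw [h1]
  rw [integral_exp_gaussianArray, integral_exp_gaussianArray, h2]

end GaussianArray

/-! ### Law of large numbers, applied to Gram matrices of Gaussian arrays. -/

section LargeNumbers

/-- Weak law of large numbers with Chebyshev's bound, for empirical means under `μ ^ ι`. -/
lemma measureReal_pi_le_of_sq_integral_le {α ι : Type*} [MeasurableSpace α] [Fintype ι] [Nonempty ι]
    (μ : Measure α) [IsProbabilityMeasure μ] {h : α → ℝ} (hh : MemLp h 2 μ) {K : ℝ}
    (hK : ∫ x, h x ^ 2 ∂μ ≤ K) {ε : ℝ} (hε : 0 < ε) :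
    (Measure.pi fun _ : ι => μ).real
        {z | ε ≤ |(∑ q, h (z q)) / Fintype.card ι - ∫ x, h x ∂μ|} ≤
      K / ε ^ 2 / Fintype.card ι := by
  set n : ℝ := ((Fintype.card ι : ℕ) : ℝ) with hn
  have hn0 : 0 < n := Nat.cast_pos.2 Fintype.card_pos
  have hq (q : ι) : MemLp (fun z : ι → α => h (z q)) 2 (Measure.pi fun _ : ι => μ) :=
    hh.comp_measurePreserving (measurePreserving_eval (fun _ : ι => μ) q)
  have hint (q : ι) : ∫ z : ι → α, h (z q) ∂(Measure.pi fun _ : ι => μ) = ∫ x, h x ∂μ := by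
    have := measurePreserving_eval (fun _ : ι => μ) q
    have h1 := integral_map (f := h) this.measurable.aemeasurable
      (by rw [this.map_eq]; exact hh.aestronglyMeasurable)
    rw [this.map_eq] at h1
    exact h1.symm
  have hX : MemLp (∑ q, fun z : ι → α => h (z q)) 2 (Measure.pi fun _ : ι => μ) :=
    memLp_finsetSum' _ fun q _ => hq q
  have hE : ∫ z, (∑ q, fun z : ι → α => h (z q)) z ∂(Measure.pi fun _ : ι => μ) =
      n * ∫ x, h x ∂μ := by
    simp only [Finset.sum_apply]
    rw [integral_finsetSum _ fun q _ => (hq q).integrable (by norm_num)]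
    simp [hint, hn]
  -- Only a bound on the second moment enters, so one `K` can serve a whole family of functions `h`.
  have hV : variance (∑ q, fun z : ι → α => h (z q)) (Measure.pi fun _ : ι => μ) ≤ n * K := by
    rw [variance_sum_pi (X := fun _ => h) fun _ => hh]
    simp only [Finset.sum_const, Finset.card_univ, nsmul_eq_mul]
    exact mul_le_mul_of_nonneg_left
      ((variance_le_expectation_sq hh.aestronglyMeasurable).trans hK) hn0.le
  have := meas_ge_le_variance_div_sq hX (mul_pos hn0 hε)
  rw [hE] at this
  have hset : {z : ι → α | ε ≤ |(∑ q, h (z q)) / n - ∫ x, h x ∂μ|} =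
      {z | n * ε ≤ |(∑ q, fun z : ι → α => h (z q)) z - n * ∫ x, h x ∂μ|} := by
    ext z
    have : (∑ q, h (z q)) / n - ∫ x, h x ∂μ = (∑ q, h (z q) - n * ∫ x, h x ∂μ) / n := by
      field_simp
    simp only [Set.mem_ofPred_eq, Finset.sum_apply]
    rw [this, abs_div, abs_of_pos hn0, le_div_iff₀ hn0, mul_comm]
  rw [hset, measureReal_def]
  refine (ENNReal.toReal_mono ENNReal.ofReal_ne_top this).trans ?_
  rw [ENNReal.toReal_ofReal (div_nonneg (variance_nonneg _ _) (by positivity))]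
  calc _ ≤ n * K / (n * ε) ^ 2 := by gcongr
    _ = _ := by field_simp

end LargeNumbers

section GaussianMoments

variable {κ : Type*} [Fintype κ]

lemma memLp_gaussianRow_apply (i : κ) (n : ℕ) : MemLp (fun z : κ → ℂ => z i) n (gaussianRow κ) :=
  (memLp_complexGaussian 1 n).comp_measurePreserving
    (measurePreserving_eval (fun _ : κ => complexGaussian 1) i)

/-- This square-integrable function dominates both the Gram entries and, up to `‖f‖`, the values of
`quadExtension f`. -/
lemma memLp_sum_norm_sq_gaussianRow :
    MemLp (fun z : κ → ℂ => ∑ i, ‖z i‖ ^ 2) 2 (gaussianRow κ) := by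
  refine memLp_finsetSum _ fun i _ => ?_
  have h := (memLp_gaussianRow_apply i 4).norm_rpow_div 2
  have h2 : ((4 : ℕ) : ENNReal) / 2 = 2 := by
    refine ((ENNReal.eq_div_iff (by simp) (by simp)).2 ?_).symm
    norm_num
  rw [h2] at h
  simpa using h

lemma integral_gaussianRow_apply {E : Type*} [NormedAddCommGroup E] [NormedSpace ℝ E]
    (i : κ) (g : ℂ → E) (hg : Continuous g) :
    ∫ z, g (z i) ∂gaussianRow κ = ∫ w, g w ∂complexGaussian 1 := by
  have := measurePreserving_eval (fun _ : κ => complexGaussian 1) i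
  rw [← this.map_eq, integral_map this.measurable.aemeasurable hg.aestronglyMeasurable]
  rfl

lemma integral_conj_mul_gaussianRow [DecidableEq κ] (i j : κ) :
    ∫ z, starRingEnd ℂ (z i) * z j ∂gaussianRow κ = if i = j then 1 else 0 := by
  split_ifs with hij
  · subst hij
    have h (w : ℂ) : starRingEnd ℂ w * w = ((‖w‖ ^ 2 : ℝ) : ℂ) := by
      rw [Complex.conj_mul']; push_cast; rfl
    simp_rw [h]
    rw [integral_complex_ofReal, integral_gaussianRow_apply i (fun w => ‖w‖ ^ 2) (by fun_prop),
      integral_norm_sq_complexGaussian]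
    simp
  · have hind : (fun z : κ → ℂ => starRingEnd ℂ (z i)) ⟂ᵢ[gaussianRow κ] fun z => z j :=
      ((iIndepFun_pi (μ := fun _ : κ => complexGaussian 1) (X := fun _ w => w)
        fun _ => aemeasurable_id).indepFun hij).comp (φ := fun w => starRingEnd ℂ w) (ψ := id)
        (by fun_prop) measurable_id
    rw [hind.integral_fun_mul_eq_mul_integral
      (Complex.continuous_conj.comp (continuous_apply i)).aestronglyMeasurable
      (continuous_apply j).aestronglyMeasurable,
      integral_gaussianRow_apply j (fun w => w) continuous_id, integral_complexGaussian, mul_zero]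

/-- The Gram matrix of the normalized columns of an `n × κ` Gaussian array is close to the identity
with high probability. -/
lemma exists_gaussianArray_gram_le (κ : Type*) [Fintype κ] [DecidableEq κ] {η : ℝ} (hη : 0 < η) :
    ∃ C : ℝ, ∀ n : ℕ, 0 < n → (gaussianArray (Fin n) κ).real
      {z | ∃ i j, η ≤ ‖(∑ q, starRingEnd ℂ (z q i) * z q j) / n - if i = j then 1 else 0‖} ≤
        C / n := by
  set K := ∫ z : κ → ℂ, (∑ i, ‖z i‖ ^ 2) ^ 2 ∂gaussianRow κ with hK
  -- Union bound over the entries `(i, j)`, with one Chebyshev bound each for the real and the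
  -- imaginary part at level `η / 2`.
  refine ⟨∑ _i : κ, ∑ _j : κ, (K / (η / 2) ^ 2 + K / (η / 2) ^ 2), fun n hn => ?_⟩
  have : Nonempty (Fin n) := ⟨⟨0, hn⟩⟩
  have hbd (i j : κ) (z : κ → ℂ) : ‖starRingEnd ℂ (z i) * z j‖ ≤ ∑ l, ‖z l‖ ^ 2 := by
    have h1 := Finset.single_le_sum (f := fun l => ‖z l‖ ^ 2) (fun l _ => by positivity)
      (Finset.mem_univ i)
    have h2 := Finset.single_le_sum (f := fun l => ‖z l‖ ^ 2) (fun l _ => by positivity)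
      (Finset.mem_univ j)
    rw [norm_mul, RCLike.norm_conj]
    nlinarith [sq_nonneg (‖z i‖ - ‖z j‖)]
  have key (L : ℂ →L[ℝ] ℝ) (hL : ∀ w, |L w| ≤ ‖w‖) (i j : κ) :
      (gaussianArray (Fin n) κ).real {z | η / 2 ≤
        |L ((∑ q, starRingEnd ℂ (z q i) * z q j) / n - if i = j then 1 else 0)|} ≤
          K / (η / 2) ^ 2 / n := by
    have hb (z : κ → ℂ) : |L (starRingEnd ℂ (z i) * z j)| ≤ ∑ l, ‖z l‖ ^ 2 :=
      (hL _).trans (hbd i j z)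
    have hm : MemLp (fun z : κ → ℂ => L (starRingEnd ℂ (z i) * z j)) 2 (gaussianRow κ) :=
      memLp_sum_norm_sq_gaussianRow.mono' (by fun_prop) (Filter.Eventually.of_forall hb)
    have hm' : Integrable (fun z : κ → ℂ => starRingEnd ℂ (z i) * z j) (gaussianRow κ) :=
      (memLp_sum_norm_sq_gaussianRow.integrable (by norm_num)).mono' (by fun_prop)
        (Filter.Eventually.of_forall (hbd i j))
    have hsq : ∫ z : κ → ℂ, (L (starRingEnd ℂ (z i) * z j)) ^ 2 ∂gaussianRow κ ≤ K := by
      refine integral_mono hm.integrable_sq memLp_sum_norm_sq_gaussianRow.integrable_sq fun z => ?_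
      exact sq_le_sq' (abs_le.1 (hb z)).1 (abs_le.1 (hb z)).2
    have := measureReal_pi_le_of_sq_integral_le (ι := Fin n) (gaussianRow κ) hm hsq (half_pos hη)
    rw [L.integral_comp_comm hm', integral_conj_mul_gaussianRow, Fintype.card_fin] at this
    have e (z : Fin n → κ → ℂ) :
        L ((∑ q, starRingEnd ℂ (z q i) * z q j) / n - if i = j then 1 else 0) =
          (∑ q, L (starRingEnd ℂ (z q i) * z q j)) / n - L (if i = j then 1 else 0) := by
      rw [map_sub, div_eq_inv_mul, ← Complex.ofReal_natCast, ← Complex.ofReal_inv,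
        ← Complex.real_smul, map_smul, map_sum, smul_eq_mul, div_eq_inv_mul]
    simp_rw [e]
    exact this
  have hsub : {z : Fin n → κ → ℂ | ∃ i j, η ≤
      ‖(∑ q, starRingEnd ℂ (z q i) * z q j) / n - if i = j then 1 else 0‖} ⊆
      ⋃ i, ⋃ j, ({z | η / 2 ≤ |Complex.reCLM
        ((∑ q, starRingEnd ℂ (z q i) * z q j) / n - if i = j then 1 else 0)|} ∪
        {z | η / 2 ≤ |Complex.imCLM
        ((∑ q, starRingEnd ℂ (z q i) * z q j) / n - if i = j then 1 else 0)|}) := by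
    rintro z ⟨i, j, hz⟩
    refine Set.mem_iUnion₂.2 ⟨i, j, ?_⟩
    by_contra hcon
    simp only [Set.mem_union, Set.mem_ofPred_eq, not_or, not_le, Complex.reCLM_apply,
      Complex.imCLM_apply] at hcon
    have := Complex.norm_le_abs_re_add_abs_im
      ((∑ q, starRingEnd ℂ (z q i) * z q j) / n - if i = j then 1 else 0)
    linarith [hcon.1, hcon.2]
  refine (measureReal_mono hsub).trans ?_
  rw [Finset.sum_div]
  refine (measureReal_iUnion_fintype_le _).trans (Finset.sum_le_sum fun i _ => ?_)
  rw [Finset.sum_div]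
  refine (measureReal_iUnion_fintype_le _).trans (Finset.sum_le_sum fun j _ => ?_)
  rw [add_div]
  exact (measureReal_union_le _ _).trans
    (add_le_add (key _ Complex.abs_re_le_norm i j) (key _ Complex.abs_im_le_norm i j))

end GaussianMoments

/-! ### Orthonormalization with error control. -/

section NearlyOrthonormal

/-- A finite family of vectors whose Gram matrix is close to the identity is close to an orthonormal
family. -/
lemma exists_orthonormal_near (k : ℕ) {θ : ℝ} (hθ : 0 < θ) :
    ∃ η > 0, ∀ (H : Type v) [NormedAddCommGroup H] [InnerProductSpace ℂ H] (x : Fin k → H),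
      (∀ i j, ‖⟪x i, x j⟫_ℂ - if i = j then 1 else 0‖ < η) →
        ∃ w : Fin k → H, Orthonormal ℂ w ∧ ∀ i, ‖w i - x i‖ ≤ θ := by
  induction k generalizing θ with
  | zero =>
    exact ⟨1, one_pos, fun H _ _ x _ => ⟨x, ⟨fun i => i.elim0, fun i => i.elim0⟩, fun i => i.elim0⟩⟩
  | succ k ih =>
    -- Gram–Schmidt on the last vector: removing its projection costs `3kt` and normalizing costs `t
    -- + 3kt`. This `t` keeps the total below `θ` and the remainder nonzero.
    set t : ℝ := min θ 1 / (8 * (k + 1)) with ht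
    have ht0 : 0 < t := by positivity
    have hkt : 8 * (k + 1) * t = min θ 1 := by rw [ht]; field_simp
    have hkt' : 8 * (k * t) + 8 * t = min θ 1 := by rw [← hkt]; ring
    have hkt0 : 0 ≤ k * t := by positivity
    obtain ⟨η', hη', hk⟩ := ih ht0
    refine ⟨min η' t, lt_min hη' ht0, fun H _ _ x hx => ?_⟩
    obtain ⟨w, hw, hwx⟩ := hk H (fun i => x i.castSucc) fun i j => by
      simpa using (hx i.castSucc j.castSucc).trans_le (min_le_left _ _)
    set y := x (Fin.last k) with hy
    have hyn : |‖y‖ - 1| ≤ t := by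
      have h1 := (hx (Fin.last k) (Fin.last k)).le.trans (min_le_right _ _)
      rw [if_pos rfl, inner_self_eq_norm_sq_to_K] at h1
      have h2 : |‖y‖ ^ 2 - 1| ≤ t := by
        rw [← Real.norm_eq_abs, ← Complex.norm_real]
        simpa using h1
      refine le_trans ?_ h2
      rw [show ‖y‖ ^ 2 - 1 = (‖y‖ - 1) * (‖y‖ + 1) by ring, abs_mul]
      refine le_mul_of_one_le_right (abs_nonneg _) ?_
      rw [abs_of_nonneg (by positivity)]
      linarith [norm_nonneg y]
    have ht8 : 8 * t ≤ 1 := by linarith [min_le_right θ 1]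
    have hy2 : ‖y‖ ≤ 2 := by linarith [(abs_le.1 hyn).2]
    set s := ∑ j, ⟪w j, y⟫_ℂ • w j with hs
    have hsn : ‖s‖ ≤ 3 * (k * t) := by
      calc ‖s‖ ≤ ∑ j, ‖⟪w j, y⟫_ℂ • w j‖ := norm_sum_le _ _
        -- `t` from the Gram entry of `x`, and `2t` from replacing `x j` by `w j`, as `‖y‖ ≤ 2`.
        _ ≤ ∑ _j : Fin k, 3 * t := by
          refine Finset.sum_le_sum fun j _ => ?_
          rw [norm_smul, hw.1 j, mul_one]
          have e : ⟪w j, y⟫_ℂ = ⟪x j.castSucc, y⟫_ℂ + ⟪w j - x j.castSucc, y⟫_ℂ := by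
            rw [inner_sub_left]; ring
          have h1 := (hx j.castSucc (Fin.last k)).le.trans (min_le_right _ _)
          rw [if_neg (Fin.castSucc_lt_last j).ne, sub_zero] at h1
          have h2 : ‖⟪w j - x j.castSucc, y⟫_ℂ‖ ≤ t * 2 :=
            (norm_inner_le_norm _ _).trans
              (mul_le_mul (hwx j) hy2 (norm_nonneg _) ht0.le)
          rw [e]
          linarith [norm_add_le ⟪x j.castSucc, y⟫_ℂ ⟪w j - x j.castSucc, y⟫_ℂ]
        _ = _ := by simp; ring
    set r := y - s with hr
    have hwr (j : Fin k) : ⟪w j, r⟫_ℂ = 0 := by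
      rw [hr, inner_sub_right, hs, hw.inner_right_fintype, sub_self]
    have hrn : |‖r‖ - 1| ≤ t + 3 * (k * t) := by
      have h1 : |‖r‖ - ‖y‖| ≤ ‖s‖ := by
        have := abs_norm_sub_norm_le r y
        rwa [hr, sub_sub_cancel_left, norm_neg] at this
      calc |‖r‖ - 1| ≤ |‖r‖ - ‖y‖| + |‖y‖ - 1| := abs_sub_le _ _ _
        _ ≤ _ := by linarith
    have hr0 : 0 < ‖r‖ := by
      linarith [(abs_le.1 hrn).1, min_le_right θ 1]
    set a := ((‖r‖⁻¹ : ℝ) : ℂ) • r with ha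
    have han : ‖a‖ = 1 := by
      rw [ha, norm_smul, Complex.norm_real, norm_inv, norm_norm, inv_mul_cancel₀ hr0.ne']
    have hwa (j : Fin k) : ⟪w j, a⟫_ℂ = 0 := by rw [ha, inner_smul_right, hwr, mul_zero]
    have hay : ‖a - y‖ ≤ θ := by
      have h1 : ‖a - r‖ = |‖r‖ - 1| := by
        have : a - r = ((‖r‖⁻¹ - 1 : ℝ) : ℂ) • r := by
          rw [ha]; push_cast; rw [sub_smul, one_smul]
        rw [this, norm_smul, Complex.norm_real, Real.norm_eq_abs, abs_sub_comm]
        nth_rewrite 2 [← abs_of_pos hr0]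
        rw [← abs_mul, sub_mul, inv_mul_cancel₀ hr0.ne', one_mul]
      have h2 : ‖r - y‖ = ‖s‖ := by rw [hr, sub_sub_cancel_left, norm_neg]
      have h3 := norm_sub_le_norm_sub_add_norm_sub a r y
      linarith [min_le_left θ 1]
    refine ⟨Fin.snoc w a, ⟨fun i => ?_, fun i j hij => ?_⟩, fun i => ?_⟩
    · refine Fin.lastCases ?_ (fun i => ?_) i
      · simpa using han
      · simpa using hw.1 i
    · revert hij
      refine Fin.lastCases ?_ (fun i => ?_) i <;> refine Fin.lastCases ?_ (fun j => ?_) j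
      · simp
      · intro _
        simpa using inner_eq_zero_symm.1 (hwa j)
      · intro _
        simpa using hwa i
      · intro hij
        simpa using hw.2 (fun h => hij (by rw [h]))
    · refine Fin.lastCases ?_ (fun i => ?_) i
      · simpa using hay
      · refine (?_ : _ ≤ t).trans (by linarith [min_le_left θ 1])
        simpa using hwx i

end NearlyOrthonormal

/-! ### Homogeneous extensions of functions on the sphere. -/

section HomogeneousExtension

variable {H : Type*} [NormedAddCommGroup H] [InnerProductSpace ℂ H]

open Classical in
/-- The extension of a function on the unit sphere by zero to the origin, and constant along rays. -/
noncomputable def radialExtension (f : Metric.sphere (0 : H) 1 → ℝ) (ψ : H) : ℝ :=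
  if h : ψ ≠ 0 then f (proj ⟨ψ, h⟩) else 0

/-- The homogeneous extension of degree two of a function on the unit sphere. -/
noncomputable def quadExtension (f : Metric.sphere (0 : H) 1 → ℝ) (ψ : H) : ℝ :=
  ‖ψ‖ ^ 2 * radialExtension f ψ

lemma radialExtension_of_ne (f : Metric.sphere (0 : H) 1 → ℝ) (ψ : {ψ : H // ψ ≠ 0}) :
    radialExtension f (ψ : H) = f (proj ψ) := by
  rw [radialExtension, dif_pos ψ.2]

@[simp]
lemma radialExtension_zero (f : Metric.sphere (0 : H) 1 → ℝ) : radialExtension f 0 = 0 := by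
  simp [radialExtension]

lemma continuous_proj : Continuous (proj : {ψ : H // ψ ≠ 0} → Metric.sphere (0 : H) 1) := by
  refine Continuous.subtype_mk (Continuous.smul ?_ continuous_subtype_val) _
  exact Complex.continuous_ofReal.comp
    (continuous_subtype_val.norm.inv₀ fun ψ => norm_ne_zero_iff.2 ψ.2)

lemma proj_smul (ψ : {ψ : H // ψ ≠ 0}) {r : ℝ} (hr : 0 < r) (h : (r : ℂ) • (ψ : H) ≠ 0) :
    proj ⟨(r : ℂ) • (ψ : H), h⟩ = proj ψ := by
  ext
  simp only [proj, norm_smul, Complex.norm_real, Real.norm_eq_abs, abs_of_pos hr, smul_smul]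
  congr 1
  rw [← Complex.ofReal_mul, mul_inv_rev, mul_assoc, inv_mul_cancel₀ hr.ne', mul_one]

lemma quadExtension_smul (f : Metric.sphere (0 : H) 1 → ℝ) {r : ℝ} (hr : 0 < r) (ψ : H) :
    quadExtension f ((r : ℂ) • ψ) = r ^ 2 * quadExtension f ψ := by
  by_cases h : ψ = 0
  · simp [quadExtension, h]
  · have h' : (r : ℂ) • ψ ≠ 0 := smul_ne_zero (by exact_mod_cast hr.ne') h
    rw [quadExtension, quadExtension, radialExtension_of_ne f ⟨_, h'⟩,
      radialExtension_of_ne f ⟨ψ, h⟩, proj_smul ⟨ψ, h⟩ hr, norm_smul, Complex.norm_real,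
      Real.norm_eq_abs, abs_of_pos hr]
    ring

variable (f : BoundedContinuousFunction (Metric.sphere (0 : H) 1) ℝ)

lemma abs_radialExtension_le (ψ : H) : |radialExtension f ψ| ≤ ‖f‖ := by
  unfold radialExtension
  split_ifs
  · exact f.norm_coe_le_norm _
  · simp

lemma abs_quadExtension_le (ψ : H) : |quadExtension f ψ| ≤ ‖f‖ * ‖ψ‖ ^ 2 := by
  rw [quadExtension, abs_mul, abs_of_nonneg (by positivity), mul_comm]
  exact mul_le_mul_of_nonneg_right (abs_radialExtension_le f ψ) (by positivity)

/-- The factor `‖ψ‖ ^ 2` restores continuity at the origin, where the radial extension may jump. -/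
lemma continuous_quadExtension : Continuous (quadExtension f) := by
  refine continuous_iff_continuousAt.2 fun ψ => ?_
  by_cases h : ψ = 0
  · subst h
    have h0 : quadExtension f 0 = 0 := by simp [quadExtension]
    rw [ContinuousAt, h0]
    refine squeeze_zero_norm (abs_quadExtension_le f) ?_
    have : Continuous fun ψ : H => ‖f‖ * ‖ψ‖ ^ 2 := by fun_prop
    simpa using this.tendsto 0
  · have ho : IsOpen {ψ : H | ψ ≠ 0} := isOpen_ne
    have hc : ContinuousOn (quadExtension f) {ψ : H | ψ ≠ 0} := by
      rw [continuousOn_iff_continuous_domRestrict]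
      have : Continuous fun ψ : {ψ : H // ψ ≠ 0} => ‖(ψ : H)‖ ^ 2 * f (proj ψ) :=
        (continuous_subtype_val.norm.pow 2).mul (f.continuous.comp continuous_proj)
      refine this.congr fun ψ => ?_
      exact congrArg (‖(ψ : H)‖ ^ 2 * ·) (radialExtension_of_ne f ψ).symm
    exact hc.continuousAt (ho.mem_nhds h)

/-- A quantitative form of continuity of the homogeneous extension, uniform on the whole space. -/
lemma exists_abs_quadExtension_sub_le [FiniteDimensional ℂ H] {η : ℝ} (hη : 0 < η) :
    ∃ C, 0 ≤ C ∧ ∀ x y : H, |quadExtension f x - quadExtension f y| ≤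
      η * (‖x‖ ^ 2 + ‖y‖ ^ 2) + C * ‖x - y‖ ^ 2 := by
  have : ProperSpace H := FiniteDimensional.proper ℂ H
  have huc := (isCompact_closedBall (0 : H) 1).uniformContinuousOn_of_continuous
    (continuous_quadExtension f).continuousOn
  obtain ⟨θ, hθ, huc⟩ := Metric.uniformContinuousOn_iff.1 huc η hη
  -- Scaling by `r⁻¹` reduces nearby points to uniform continuity on the unit ball. If `‖x - y‖ ≥ θ
  -- r`, the trivial bound `2‖f‖r²` is at most this constant times `‖x - y‖ ^ 2`.
  refine ⟨2 * ‖f‖ / θ ^ 2, by positivity, fun x y => ?_⟩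
  set r := max ‖x‖ ‖y‖ with hr
  have hxr : ‖x‖ ≤ r := le_max_left _ _
  have hyr : ‖y‖ ≤ r := le_max_right _ _
  have hr2 : r ^ 2 ≤ ‖x‖ ^ 2 + ‖y‖ ^ 2 := by
    rcases max_choice ‖x‖ ‖y‖ with h | h <;> rw [hr, h] <;> nlinarith [norm_nonneg x, norm_nonneg y]
  rcases (norm_nonneg x |>.trans hxr).eq_or_lt' with hr0 | hr0
  · have hx : x = 0 := norm_le_zero_iff.1 (hr0 ▸ hxr)
    have hy : y = 0 := norm_le_zero_iff.1 (hr0 ▸ hyr)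
    simp [hx, hy]
  by_cases hxy : ‖x - y‖ < θ * r
  · have hn (w : H) : ‖((r⁻¹ : ℝ) : ℂ) • w‖ = r⁻¹ * ‖w‖ := by
      rw [norm_smul, Complex.norm_real, Real.norm_eq_abs, abs_of_pos (inv_pos.2 hr0)]
    have hmem (w : H) (hw : ‖w‖ ≤ r) : ((r⁻¹ : ℝ) : ℂ) • w ∈ Metric.closedBall (0 : H) 1 := by
      rw [mem_closedBall_zero_iff, hn, inv_mul_le_iff₀ hr0, mul_one]
      exact hw
    have h1 := huc _ (hmem x hxr) _ (hmem y hyr) (by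
      rwa [dist_eq_norm, ← smul_sub, hn, inv_mul_lt_iff₀ hr0, mul_comm])
    rw [Real.dist_eq, quadExtension_smul f (inv_pos.2 hr0), quadExtension_smul f (inv_pos.2 hr0),
      ← mul_sub, abs_mul, abs_of_pos (by positivity), inv_pow, inv_mul_lt_iff₀ (by positivity)] at h1
    have h2 : 0 ≤ 2 * ‖f‖ / θ ^ 2 * ‖x - y‖ ^ 2 := by positivity
    nlinarith
  · have h1 : r ^ 2 ≤ ‖x - y‖ ^ 2 / θ ^ 2 := by
      rw [le_div_iff₀ (by positivity), ← mul_pow, mul_comm r]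
      exact pow_le_pow_left₀ (by positivity) (not_lt.1 hxy) 2
    have h2 : |quadExtension f x - quadExtension f y| ≤ 2 * ‖f‖ * r ^ 2 := by
      refine (abs_sub _ _).trans ?_
      have hx2 : ‖x‖ ^ 2 ≤ r ^ 2 := pow_le_pow_left₀ (norm_nonneg _) hxr 2
      have hy2 : ‖y‖ ^ 2 ≤ r ^ 2 := pow_le_pow_left₀ (norm_nonneg _) hyr 2
      nlinarith [abs_quadExtension_le f x, abs_quadExtension_le f y,
        mul_le_mul_of_nonneg_left hx2 (norm_nonneg f), mul_le_mul_of_nonneg_left hy2 (norm_nonneg f)]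
    have h3 : 2 * ‖f‖ * r ^ 2 ≤ 2 * ‖f‖ * (‖x - y‖ ^ 2 / θ ^ 2) :=
      mul_le_mul_of_nonneg_left h1 (by positivity)
    have h4 : 2 * ‖f‖ * (‖x - y‖ ^ 2 / θ ^ 2) = 2 * ‖f‖ / θ ^ 2 * ‖x - y‖ ^ 2 := by ring
    have h5 : 0 ≤ η * (‖x‖ ^ 2 + ‖y‖ ^ 2) := by positivity
    linarith

end HomogeneousExtension

/-! ### Both measures on the sphere as averages of `quadExtension`. -/

section ProjectedMeasures

variable {H : Type*} [NormedAddCommGroup H] [InnerProductSpace ℂ H] [MeasurableSpace H]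
  [BorelSpace H]

/-- `projMeasure` discards mass at the origin, in agreement with the value zero of `radialExtension`
there. -/
lemma integral_projMeasure (μ : Measure H) (f : BoundedContinuousFunction (Metric.sphere (0 : H) 1) ℝ) :
    ∫ φ, f φ ∂projMeasure μ = ∫ ψ, radialExtension f ψ ∂μ := by
  have hs : MeasurableSet {ψ : H | ψ ≠ 0} := isOpen_ne.measurableSet
  rw [projMeasure, integral_map continuous_proj.measurable.aemeasurable
    f.continuous.aestronglyMeasurable]
  simp_rw [← radialExtension_of_ne]
  refine ((MeasurableEmbedding.subtype_coe hs).integral_map (μ := μ.comap Subtype.val)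
    (radialExtension f)).symm.trans ?_
  rw [(MeasurableEmbedding.subtype_coe hs).map_comap, Subtype.range_coe]
  refine setIntegral_eq_integral_of_forall_compl_eq_zero fun ψ hψ => ?_
  have : ψ = 0 := by simpa using hψ
  simp [this]

lemma integral_conditionalWaveLaw {H₂ : Type*} [NormedAddCommGroup H₂] [InnerProductSpace ℂ H₂]
    {ι : Type*} [Fintype ι] [MeasurableSpace ι] [DiscreteMeasurableSpace ι]
    (b : OrthonormalBasis ι ℂ H₂) (ψ : H ⊗[ℂ] H₂)
    (f : BoundedContinuousFunction (Metric.sphere (0 : H) 1) ℝ) :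
    ∫ φ, f φ ∂conditionalWaveLaw b ψ = ∑ q, quadExtension f (partialInner (b q) ψ) := by
  have hm : Measurable (radialExtension f) := by
    have : radialExtension f = fun ψ => (‖ψ‖ ^ 2)⁻¹ * quadExtension f ψ := by
      ext ψ
      by_cases h : ψ = 0
      · simp [h]
      · rw [quadExtension, inv_mul_cancel_left₀ (by simpa using h)]
    rw [this]
    have := (continuous_quadExtension f).measurable
    fun_prop
  rw [conditionalWaveLaw, integral_projMeasure, integral_map Measurable.of_discrete.aemeasurable hm.aestronglyMeasurable,
    quantumDistribution, integral_finsetSum_measure]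
  · refine Finset.sum_congr rfl fun q _ => ?_
    rw [integral_smul_measure, integral_dirac, ENNReal.toReal_ofReal (by positivity), smul_eq_mul,
      quadExtension]
  · intro q _
    exact (integrable_dirac (by simp)).smul_measure ENNReal.ofReal_ne_top

variable [FiniteDimensional ℂ H]

/-- Rescaling the coordinates moves all dependence on `ρ` from the measure into the integrand, so
one standard Gaussian law serves every `ρ`. -/
lemma integral_gapMeasure (ρ : H →ₗ[ℂ] H) (hρ : ρ.IsPositive)
    (f : BoundedContinuousFunction (Metric.sphere (0 : H) 1) ℝ) :
    ∫ φ, f φ ∂gapMeasure ρ hρ =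
      ∫ z, quadExtension f (∑ i, z i • ((√(hρ.isSymmetric.eigenvalues rfl i) : ℂ) •
        hρ.isSymmetric.eigenvectorBasis rfl i)) ∂gaussianRow (Fin (finrank ℂ H)) := by
  have hq := continuous_quadExtension f
  rw [gapMeasure, integral_projMeasure, gaMeasure,
    integral_withDensity_eq_integral_toReal_smul (by fun_prop) (by simp)]
  have h (ψ : H) : (ENNReal.ofReal (‖ψ‖ ^ 2)).toReal • radialExtension f ψ = quadExtension f ψ := by
    rw [ENNReal.toReal_ofReal (by positivity), smul_eq_mul, quadExtension]
  simp_rw [h]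
  have hc : Continuous fun z : Fin (finrank ℂ H) → ℂ =>
    ∑ n, z n • hρ.isSymmetric.eigenvectorBasis rfl n := by fun_prop
  have hqc : Continuous fun z : Fin (finrank ℂ H) → ℂ =>
    quadExtension f (∑ n, z n • hρ.isSymmetric.eigenvectorBasis rfl n) := hq.comp hc
  have hpi : (Measure.pi fun n => complexGaussian (hρ.isSymmetric.eigenvalues rfl n)) =
      (gaussianRow (Fin (finrank ℂ H))).map
        fun z n => (√(hρ.isSymmetric.eigenvalues rfl n) : ℂ) * z n := by
    have := fun n => complexGaussian_map_const_mul (hρ.nonneg_eigenvalues rfl n)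
    simp_rw [← this]
    refine (Measure.pi_map_pi (μ := fun _ => complexGaussian 1) (hμ := fun n => ?_)
      (f := fun n z => (√(hρ.isSymmetric.eigenvalues rfl n) : ℂ) * z) fun n => by fun_prop).symm
    rw [this]
    infer_instance
  rw [gaussianMeasure, integral_map hc.measurable.aemeasurable hq.aestronglyMeasurable, hpi,
    integral_map (measurable_pi_lambda _ fun n => (measurable_pi_apply n).const_mul _).aemeasurable
      hqc.aestronglyMeasurable]
  simp_rw [smul_smul, mul_comm]

end ProjectedMeasures

/-! ### Reduced density matrix and Schmidt decomposition. -/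

section Schmidt

variable {H₁ H₂ : Type*} [NormedAddCommGroup H₁] [InnerProductSpace ℂ H₁]
  [NormedAddCommGroup H₂] [InnerProductSpace ℂ H₂]

/-- The partial scalar product `⟨x|ψ⟩ ∈ H₂`, taken in `H₁`. -/
noncomputable def partialInnerLeft (x : H₁) : H₁ ⊗[ℂ] H₂ →ₗ[ℂ] H₂ :=
  (TensorProduct.lid ℂ H₂).toLinearMap ∘ₗ LinearMap.rTensor H₂ (innerₛₗ ℂ x)

lemma inner_partialInnerLeft (x : H₁) (y : H₂) (ψ : H₁ ⊗[ℂ] H₂) :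
    ⟪y, partialInnerLeft x ψ⟫_ℂ = ⟪x ⊗ₜ[ℂ] y, ψ⟫_ℂ := by
  induction ψ using TensorProduct.induction_on with
  | zero => simp
  | tmul a b => simp [partialInnerLeft]
  | add a b ha hb => rw [map_add, inner_add_right, inner_add_right, ha, hb]

lemma partialInner_eq_sum {ι : Type*} [Fintype ι] (χ : OrthonormalBasis ι ℂ H₁) (q : H₂)
    (ψ : H₁ ⊗[ℂ] H₂) :
    partialInner q ψ = ∑ i, ⟪q, partialInnerLeft (χ i) ψ⟫_ℂ • χ i := by
  rw [← χ.sum_repr' (partialInner q ψ)]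
  simp_rw [inner_partialInner, inner_partialInnerLeft]

variable [FiniteDimensional ℂ H₂]

/-- Makes `ρ₁` a Gram matrix: along its eigenbasis the vectors `partialInnerLeft (χ i) ψ` are
orthogonal with squared norms the eigenvalues. -/
lemma inner_reducedDensity (x y : H₁) (ψ : H₁ ⊗[ℂ] H₂) :
    ⟪x, reducedDensity ψ y⟫_ℂ = ⟪partialInnerLeft y ψ, partialInnerLeft x ψ⟫_ℂ := by
  rw [← (stdOrthonormalBasis ℂ H₂).sum_inner_mul_inner]
  simp only [reducedDensity, partialTrace, LinearMap.sum_apply, inner_sum]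
  refine Finset.sum_congr rfl fun r _ => ?_
  rw [inner_partialInnerLeft, ← inner_conj_symm (partialInnerLeft y ψ), inner_partialInnerLeft]
  simp only [LinearMap.comp_apply, LinearMap.flip_apply, TensorProduct.mk_apply,
    ContinuousLinearMap.coe_coe, InnerProductSpace.rankOne_apply, map_smul, inner_smul_right,
    inner_partialInner]
  exact congrArg (· * _) (inner_conj_symm _ _).symm

lemma sum_norm_sq_partialInnerLeft {ι : Type*} [Fintype ι] (χ : OrthonormalBasis ι ℂ H₁)
    (ψ : H₁ ⊗[ℂ] H₂) : ∑ i, ‖partialInnerLeft (χ i) ψ‖ ^ 2 = ‖ψ‖ ^ 2 := by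
  rw [← (χ.tensorProduct (stdOrthonormalBasis ℂ H₂)).sum_sq_norm_inner_right ψ,
    Fintype.sum_prod_type]
  refine Finset.sum_congr rfl fun i _ => ?_
  rw [← (stdOrthonormalBasis ℂ H₂).sum_sq_norm_inner_right]
  simp [inner_partialInnerLeft]

variable [FiniteDimensional ℂ H₁]

lemma inner_partialInnerLeft_eigenvectorBasis (ψ : H₁ ⊗[ℂ] H₂) (i j : Fin (finrank ℂ H₁)) :
    ⟪partialInnerLeft ((reducedDensity_isPositive ψ).isSymmetric.eigenvectorBasis rfl i) ψ,
      partialInnerLeft ((reducedDensity_isPositive ψ).isSymmetric.eigenvectorBasis rfl j) ψ⟫_ℂ =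
      if i = j then ((reducedDensity_isPositive ψ).isSymmetric.eigenvalues rfl i : ℂ) else 0 := by
  rw [← inner_reducedDensity, LinearMap.IsSymmetric.apply_eigenvectorBasis, inner_smul_right,
    orthonormal_iff_ite.1 (OrthonormalBasis.orthonormal _)]
  simp [eq_comm]

lemma sum_eigenvalues_reducedDensity {ψ : H₁ ⊗[ℂ] H₂} (hψ : ‖ψ‖ = 1) :
    ∑ i, (reducedDensity_isPositive ψ).isSymmetric.eigenvalues rfl i = 1 := by
  rw [← one_pow 2, ← hψ, ← sum_norm_sq_partialInnerLeft
    ((reducedDensity_isPositive ψ).isSymmetric.eigenvectorBasis rfl)]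
  refine Finset.sum_congr rfl fun i _ => ?_
  have := inner_partialInnerLeft_eigenvectorBasis ψ i i
  rw [← inner_self_eq_norm_sq (𝕜 := ℂ), this, if_pos rfl]
  simp

/-- Every finite family of orthonormal vectors, restricted to a subset of the index set, extends to an
orthonormal family if the dimension permits. -/
lemma exists_orthonormal_extension {k : ℕ} (hk : k ≤ finrank ℂ H₂) (w : Fin k → H₂)
    (s : Set (Fin k)) (hw : Orthonormal ℂ (s.domRestrict w)) :
    ∃ b : OrthonormalBasis (Fin (finrank ℂ H₂)) ℂ H₂, ∀ i ∈ s, b (Fin.castLE hk i) = w i := by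
  classical
  let w' : Fin (finrank ℂ H₂) → H₂ := fun r => if h : r.1 < k then w ⟨r, h⟩ else 0
  have hw' (i : Fin k) : w' (Fin.castLE hk i) = w i := by simp [w']
  have ho : Orthonormal ℂ ((Fin.castLE hk '' s).domRestrict w') := by
    refine ⟨?_, ?_⟩
    · rintro ⟨_, i, hi, rfl⟩
      simpa [hw'] using hw.1 ⟨i, hi⟩
    · rintro ⟨_, i, hi, rfl⟩ ⟨_, j, hj, rfl⟩ hij
      have : (⟨i, hi⟩ : s) ≠ ⟨j, hj⟩ := fun h => hij (by simp_all)
      simpa [hw'] using hw.2 this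
  obtain ⟨b, hb⟩ := ho.exists_orthonormalBasis_extension_of_card_eq (by simp)
  exact ⟨b, fun i hi => by rw [hb _ ⟨i, hi, rfl⟩, hw']⟩

/-- The Schmidt decomposition, along an eigenbasis of the reduced density matrix. -/
lemma exists_schmidt (h : finrank ℂ H₁ ≤ finrank ℂ H₂) (ψ : H₁ ⊗[ℂ] H₂) :
    ∃ φ : Fin (finrank ℂ H₁) → H₂, Orthonormal ℂ φ ∧ ∀ q, partialInner q ψ =
      ∑ i, ⟪q, φ i⟫_ℂ • ((√((reducedDensity_isPositive ψ).isSymmetric.eigenvalues rfl i) : ℂ) •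
        (reducedDensity_isPositive ψ).isSymmetric.eigenvectorBasis rfl i) := by
  set χ := (reducedDensity_isPositive ψ).isSymmetric.eigenvectorBasis rfl
  set p := (reducedDensity_isPositive ψ).isSymmetric.eigenvalues rfl
  have hp (i) : 0 ≤ p i := (reducedDensity_isPositive ψ).nonneg_eigenvalues rfl i
  set y := fun i => partialInnerLeft (χ i) ψ with hy
  have hyy (i j) : ⟪y i, y j⟫_ℂ = if i = j then (p i : ℂ) else 0 :=
    inner_partialInnerLeft_eigenvectorBasis ψ i j
  -- Normalization works only where `p i ≠ 0`. Elsewhere `y i = 0`, so any orthonormal completion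
  -- will do; this is where the dimension of `H₂` matters.
  set w := fun i => ((√(p i) : ℂ))⁻¹ • y i with hw
  have ho : Orthonormal ℂ (Set.domRestrict {i | p i ≠ 0} w) := by
    rw [orthonormal_iff_ite]
    rintro ⟨i, hi⟩ ⟨j, hj⟩
    simp only [Set.domRestrict_apply, hw, inner_smul_left, inner_smul_right, hyy, Subtype.mk.injEq]
    split_ifs with hij
    · subst hij
      have h1 : (√(p i) : ℂ) * √(p i) = p i := by
        rw [← Complex.ofReal_mul, Real.mul_self_sqrt (hp i)]
      have h2 : (p i : ℂ) ≠ 0 := by exact_mod_cast hi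
      rw [map_inv₀, Complex.conj_ofReal, ← mul_assoc, ← mul_inv, h1, inv_mul_cancel₀ h2]
    · simp
  obtain ⟨b, hb⟩ := exists_orthonormal_extension h w _ ho
  refine ⟨fun i => b (Fin.castLE h i),
    b.orthonormal.comp _ (Fin.castLE_injective h), fun q => ?_⟩
  rw [partialInner_eq_sum χ]
  refine Finset.sum_congr rfl fun i _ => ?_
  by_cases hi : p i = 0
  · have : y i = 0 := by
      rw [← inner_self_eq_zero (𝕜 := ℂ), hyy, if_pos rfl, hi, Complex.ofReal_zero]
    simp only [hy] at this
    simp [this, hi]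
  · have h2 : (√(p i) : ℂ) ≠ 0 := by
      exact_mod_cast (Real.sqrt_pos.2 (lt_of_le_of_ne (hp i) (Ne.symm hi))).ne'
    change _ = ⟪q, b (Fin.castLE h i)⟫_ℂ • _
    rw [hb i hi, smul_smul, hw, inner_smul_right, mul_comm, mul_inv_cancel_left₀ h2]

end Schmidt

/-! ### Unitary rotations and averaging over Haar measure. -/

section Rotation

variable {H : Type*} [NormedAddCommGroup H] [InnerProductSpace ℂ H] [FiniteDimensional ℂ H]

/-- Any two orthonormal families of the same size are related by a unitary. -/
lemma exists_unitary_apply_eq [CompleteSpace H] {k : ℕ} {φ w : Fin k → H} (hφ : Orthonormal ℂ φ)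
    (hw : Orthonormal ℂ w) :
    ∃ V : unitary (H →L[ℂ] H), ∀ i, Unitary.linearIsometryEquiv V (φ i) = w i := by
  have hk : k ≤ finrank ℂ H := by
    simpa using hφ.linearIndependent.fintype_card_le_finrank
  obtain ⟨b, hb⟩ := exists_orthonormal_extension hk φ Set.univ
    (hφ.comp _ Subtype.val_injective)
  obtain ⟨b', hb'⟩ := exists_orthonormal_extension hk w Set.univ
    (hw.comp _ Subtype.val_injective)
  refine ⟨Unitary.linearIsometryEquiv.symm (b.equiv b' (Equiv.refl _)), fun i => ?_⟩
  rw [MulEquiv.apply_symm_apply, ← hb i trivial, OrthonormalBasis.equiv_apply_basis,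
    Equiv.refl_apply, hb' i trivial]

end Rotation

section HaarAverage

variable (H : Type*) [NormedAddCommGroup H] [InnerProductSpace ℂ H] [FiniteDimensional ℂ H]
  [CompleteSpace H]

instance : (haarUnitary H).IsMulLeftInvariant := by
  unfold haarUnitary
  infer_instance

instance : SecondCountableTopology (unitary (H →L[ℂ] H)) :=
  have : ProperSpace (H →L[ℂ] H) := FiniteDimensional.proper ℂ _
  inferInstance

variable {H}

/-- The coordinates, in the rotated standard basis, of the family of vectors whose coordinates in the
standard basis are the columns of `z`. -/
noncomputable def rotatedArray {κ : Type*} (U : unitary (H →L[ℂ] H)) (z : Fin (finrank ℂ H) → κ → ℂ) :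
    Fin (finrank ℂ H) → κ → ℂ :=
  fun q i => ⟪(U : H →L[ℂ] H) (stdOrthonormalBasis ℂ H q), ∑ r, z r i • stdOrthonormalBasis ℂ H r⟫_ℂ

lemma continuous_rotatedArray {κ : Type*} :
    Continuous fun x : (Fin (finrank ℂ H) → κ → ℂ) × unitary (H →L[ℂ] H) =>
      rotatedArray x.2 x.1 := by
  unfold rotatedArray
  fun_prop

lemma gaussianArray_map_rotatedArray {κ : Type*} [Fintype κ] (U : unitary (H →L[ℂ] H)) :
    (gaussianArray (Fin (finrank ℂ H)) κ).map (rotatedArray U) =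
      gaussianArray (Fin (finrank ℂ H)) κ := by
  set e := stdOrthonormalBasis ℂ H
  set b := e.map (Unitary.linearIsometryEquiv U) with hb
  have hbq (q) : (U : H →L[ℂ] H) (e q) = b q := rfl
  set u : Matrix (Fin (finrank ℂ H)) (Fin (finrank ℂ H)) ℂ := Matrix.of fun q r => ⟪b q, e r⟫_ℂ
    with hu
  have hmem : u ∈ Matrix.unitaryGroup (Fin (finrank ℂ H)) ℂ := by
    rw [Matrix.mem_unitaryGroup_iff]
    ext q r
    rw [Matrix.mul_apply, Matrix.one_apply, ← orthonormal_iff_ite.1 b.orthonormal q r,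
      ← e.sum_inner_mul_inner]
    refine Finset.sum_congr rfl fun s _ => ?_
    simp [hu, Matrix.star_apply]
  -- Both occurrences of the array law are rewritten and the first is then restored, leaving two
  -- images of the same law.
  rw [← gaussianArray_map_unitary u hmem]
  nth_rewrite 1 [gaussianArray_map_unitary u hmem]
  congr 1
  ext z q i
  simp only [rotatedArray, inner_sum, inner_smul_right]
  exact Finset.sum_congr rfl fun r _ => mul_comm _ _

/-- Averaging a rotated Gaussian array over rotations. -/
lemma lintegral_haarUnitary_rotatedArray {κ : Type*} [Fintype κ]
    {B : Set (Fin (finrank ℂ H) → κ → ℂ)} (hB : MeasurableSet B) :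
    ∫⁻ z, haarUnitary H {U | rotatedArray U z ∈ B} ∂gaussianArray (Fin (finrank ℂ H)) κ =
      gaussianArray (Fin (finrank ℂ H)) κ B := by
  have hm := (continuous_rotatedArray (H := H) (κ := κ)).measurable hB
  have h1 := Measure.prod_apply (μ := gaussianArray (Fin (finrank ℂ H)) κ) (ν := haarUnitary H) hm
  rw [Measure.prod_apply_symm hm] at h1
  refine Eq.trans h1.symm ?_
  -- In the other order of integration every inner measure is the same, by unitary invariance.
  have h2 (U : unitary (H →L[ℂ] H)) : gaussianArray (Fin (finrank ℂ H)) κ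
      ((fun z => (z, U)) ⁻¹' ((fun x : (Fin (finrank ℂ H) → κ → ℂ) × unitary (H →L[ℂ] H) =>
        rotatedArray x.2 x.1) ⁻¹' B)) = gaussianArray (Fin (finrank ℂ H)) κ B := by
    have hU : Measurable (rotatedArray (κ := κ) U) :=
      (continuous_rotatedArray.comp (by fun_prop : Continuous fun z => (z, U))).measurable
    conv_rhs => rw [← gaussianArray_map_rotatedArray U, Measure.map_apply hU hB]
    rfl
  simp_rw [h2]
  simp

/-- If the events `A` and `B` are improbable under the Gaussian array, then there is an array outside
`A` most of whose rotations are outside `B`. -/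
lemma exists_rotatedArray_notMem {κ : Type*} [Fintype κ]
    {A B : Set (Fin (finrank ℂ H) → κ → ℂ)} (hA : MeasurableSet A) (hB : MeasurableSet B) {δ : ℝ}
    (hPA : (gaussianArray (Fin (finrank ℂ H)) κ).real A ≤ 1 / 2)
    (hPB : (gaussianArray (Fin (finrank ℂ H)) κ).real B < δ / 2) :
    ∃ z ∉ A, (haarUnitary H).real {U | rotatedArray U z ∈ B} < δ := by
  by_contra! hcon
  have hδ : 0 < δ := by linarith [measureReal_nonneg (μ := gaussianArray (Fin (finrank ℂ H)) κ) (s := B)]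
  -- If every array outside `A` had bad rotations of measure at least `δ`, averaging would give `B`
  -- probability at least `δ / 2`.
  have h1 : ENNReal.ofReal δ * gaussianArray (Fin (finrank ℂ H)) κ Aᶜ ≤
      gaussianArray (Fin (finrank ℂ H)) κ B := by
    rw [← lintegral_haarUnitary_rotatedArray hB, ← setLIntegral_const]
    refine (setLIntegral_mono' hA.compl fun z hz => ?_).trans (setLIntegral_le_lintegral _ _)
    exact ENNReal.ofReal_le_of_le_toReal (hcon z hz)
  have h2 := ENNReal.toReal_mono (by simp) h1
  rw [ENNReal.toReal_mul, ENNReal.toReal_ofReal hδ.le, ← measureReal_def, ← measureReal_def,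
    probReal_compl_eq_one_sub hA] at h2
  nlinarith

end HaarAverage

/-! ### Stability, concentration and transfer to Haar measure. -/

section Comparison

variable {H₁ H₂ : Type*} [NormedAddCommGroup H₁] [InnerProductSpace ℂ H₁]
  [NormedAddCommGroup H₂] [InnerProductSpace ℂ H₂] {ι κ : Type*} [Fintype ι] [Fintype κ]

lemma norm_sum_smul_sqrt_smul_sq (χ : OrthonormalBasis κ ℂ H₁) {p : κ → ℝ} (hp : ∀ i, 0 ≤ p i)
    (z : κ → ℂ) : ‖∑ i, z i • ((√(p i) : ℂ) • χ i)‖ ^ 2 = ∑ i, p i * ‖z i‖ ^ 2 := by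
  rw [← χ.sum_sq_norm_inner_right]
  refine Finset.sum_congr rfl fun i _ => ?_
  simp_rw [smul_smul]
  rw [χ.orthonormal.inner_right_fintype, norm_mul, Complex.norm_real, mul_pow, Real.norm_eq_abs,
    sq_abs, Real.sq_sqrt (hp i), mul_comm]

lemma sum_norm_sum_inner_smul_sq (b : OrthonormalBasis ι ℂ H₂) (χ : OrthonormalBasis κ ℂ H₁)
    {p : κ → ℝ} (hp : ∀ i, 0 ≤ p i) (x : κ → H₂) :
    ∑ q, ‖∑ i, ⟪b q, x i⟫_ℂ • ((√(p i) : ℂ) • χ i)‖ ^ 2 = ∑ i, p i * ‖x i‖ ^ 2 := by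
  simp_rw [norm_sum_smul_sqrt_smul_sq χ hp]
  rw [Finset.sum_comm]
  simp_rw [← Finset.mul_sum, b.sum_sq_norm_inner_right]

/-- Parseval makes the summed error independent of the basis and of its size. The `5` is `1 + 4`,
from `‖w i‖ = 1` and `‖x i‖ ≤ 2`. -/
lemma abs_sum_quadExtension_sub_le (f : BoundedContinuousFunction (Metric.sphere (0 : H₁) 1) ℝ)
    {η C θ : ℝ} (hη : 0 ≤ η) (hC : 0 ≤ C) (hθ : θ ≤ 1)
    (hf : ∀ x y : H₁, |quadExtension f x - quadExtension f y| ≤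
      η * (‖x‖ ^ 2 + ‖y‖ ^ 2) + C * ‖x - y‖ ^ 2)
    (b : OrthonormalBasis ι ℂ H₂) (χ : OrthonormalBasis κ ℂ H₁)
    {p : κ → ℝ} (hp : ∀ i, 0 ≤ p i) (hp1 : ∑ i, p i = 1) {x w : κ → H₂} (hw : ∀ i, ‖w i‖ = 1)
    (hwx : ∀ i, ‖w i - x i‖ ≤ θ) :
    |∑ q, quadExtension f (∑ i, ⟪b q, w i⟫_ℂ • ((√(p i) : ℂ) • χ i)) -
      ∑ q, quadExtension f (∑ i, ⟪b q, x i⟫_ℂ • ((√(p i) : ℂ) • χ i))| ≤ 5 * η + C * θ ^ 2 := by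
  have hsub (q) : ∑ i, ⟪b q, w i⟫_ℂ • ((√(p i) : ℂ) • χ i) -
      ∑ i, ⟪b q, x i⟫_ℂ • ((√(p i) : ℂ) • χ i) =
      ∑ i, ⟪b q, w i - x i⟫_ℂ • ((√(p i) : ℂ) • χ i) := by
    simp_rw [← Finset.sum_sub_distrib, ← sub_smul, inner_sub_right]
  have hle (y : κ → H₂) (t : ℝ) (hy : ∀ i, ‖y i‖ ≤ t) : ∑ i, p i * ‖y i‖ ^ 2 ≤ t ^ 2 := by
    calc ∑ i, p i * ‖y i‖ ^ 2 ≤ ∑ i, p i * t ^ 2 :=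
          Finset.sum_le_sum fun i _ => mul_le_mul_of_nonneg_left
            (pow_le_pow_left₀ (norm_nonneg _) (hy i) 2) (hp i)
      _ = t ^ 2 := by rw [← Finset.sum_mul, hp1, one_mul]
  have hx (i) : ‖x i‖ ≤ 2 := by
    have := norm_sub_norm_le (x i) (w i)
    rw [norm_sub_rev] at this
    linarith [hw i, hwx i]
  rw [← Finset.sum_sub_distrib]
  refine (Finset.abs_sum_le_sum_abs _ _).trans ((Finset.sum_le_sum fun q _ => hf _ _).trans ?_)
  simp_rw [hsub]
  rw [Finset.sum_add_distrib, ← Finset.mul_sum, ← Finset.mul_sum, Finset.sum_add_distrib,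
    sum_norm_sum_inner_smul_sq b χ hp, sum_norm_sum_inner_smul_sq b χ hp,
    sum_norm_sum_inner_smul_sq b χ hp]
  have h1 := hle w 1 fun i => (hw i).le
  have h2 := hle x 2 hx
  have h3 := hle _ θ hwx
  have h4 := mul_le_mul_of_nonneg_left (add_le_add h1 h2) hη
  have h5 := mul_le_mul_of_nonneg_left h3 hC
  linarith

end Comparison

section LawOfLargeNumbersForRows

variable {H : Type*} [NormedAddCommGroup H] [InnerProductSpace ℂ H] {κ : Type*} [Fintype κ]

/-- The empirical mean of the homogeneous extension over the rows of a Gaussian array concentrates,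
uniformly in the covariance. -/
lemma gaussianArray_quadExtension_le
    (f : BoundedContinuousFunction (Metric.sphere (0 : H) 1) ℝ) (χ : OrthonormalBasis κ ℂ H)
    {p : κ → ℝ} (hp : ∀ i, 0 ≤ p i) (hp1 : ∑ i, p i = 1) {ε : ℝ} (hε : 0 < ε) {n : ℕ} (hn : 0 < n) :
    (gaussianArray (Fin n) κ).real {z | ε ≤
      |(∑ q, quadExtension f (∑ i, z q i • ((√(p i) : ℂ) • χ i))) / n -
        ∫ z, quadExtension f (∑ i, z i • ((√(p i) : ℂ) • χ i)) ∂gaussianRow κ|} ≤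
      (‖f‖ ^ 2 * ∫ z : κ → ℂ, (∑ i, ‖z i‖ ^ 2) ^ 2 ∂gaussianRow κ) / ε ^ 2 / n := by
  have : Nonempty (Fin n) := ⟨⟨0, hn⟩⟩
  -- Since each `p i ≤ 1`, the dominating function does not involve `p`.
  have hle (z : κ → ℂ) : |quadExtension f (∑ i, z i • ((√(p i) : ℂ) • χ i))| ≤
      ‖f‖ * ∑ i, ‖z i‖ ^ 2 := by
    refine (abs_quadExtension_le f _).trans (mul_le_mul_of_nonneg_left ?_ (norm_nonneg _))
    rw [norm_sum_smul_sqrt_smul_sq χ hp]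
    refine Finset.sum_le_sum fun i _ => mul_le_of_le_one_left (by positivity) ?_
    rw [← hp1]
    exact Finset.single_le_sum (fun j _ => hp j) (Finset.mem_univ i)
  have hN := (memLp_sum_norm_sq_gaussianRow (κ := κ)).const_mul ‖f‖
  have hc : Continuous fun z : κ → ℂ => quadExtension f (∑ i, z i • ((√(p i) : ℂ) • χ i)) :=
    (continuous_quadExtension f).comp (by fun_prop)
  have hm : MemLp (fun z : κ → ℂ => quadExtension f (∑ i, z i • ((√(p i) : ℂ) • χ i))) 2
      (gaussianRow κ) :=
    hN.mono' hc.aestronglyMeasurable (Filter.Eventually.of_forall hle)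
  have := measureReal_pi_le_of_sq_integral_le (ι := Fin n) (gaussianRow κ) hm
    (K := ‖f‖ ^ 2 * ∫ z : κ → ℂ, (∑ i, ‖z i‖ ^ 2) ^ 2 ∂gaussianRow κ) ?_ hε
  · rwa [Fintype.card_fin] at this
  · rw [← integral_const_mul]
    simp_rw [← mul_pow]
    exact integral_mono hm.integrable_sq hN.integrable_sq fun z =>
      sq_le_sq' (abs_le.1 (hle z)).1 (abs_le.1 (hle z)).2

end LawOfLargeNumbersForRows

section Typicality

variable {H₁ H₂ : Type*} [NormedAddCommGroup H₁] [InnerProductSpace ℂ H₁]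
  [NormedAddCommGroup H₂] [InnerProductSpace ℂ H₂] [FiniteDimensional ℂ H₂]

lemma inner_sum_smul_stdOrthonormalBasis {κ : Type*} (z : Fin (finrank ℂ H₂) → κ → ℂ) (i j : κ) :
    ⟪∑ r, z r i • stdOrthonormalBasis ℂ H₂ r, ∑ r, z r j • stdOrthonormalBasis ℂ H₂ r⟫_ℂ =
      ∑ r, starRingEnd ℂ (z r i) * z r j := by
  rw [Orthonormal.inner_sum (stdOrthonormalBasis ℂ H₂).orthonormal]

/-- The Haar measure of the bases in which the quadratic functional of an orthonormal family is within
`ε` of its Gaussian mean is large. -/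
lemma one_sub_lt_haarUnitary [CompleteSpace H₂] {k : ℕ}
    (f : BoundedContinuousFunction (Metric.sphere (0 : H₁) 1) ℝ)
    {ε δ η θ η₀ C C₀ : ℝ} (hε : 0 < ε) (hη₀ : 0 ≤ η₀) (hC : 0 ≤ C) (hθ : θ ≤ 1)
    (hf : ∀ x y : H₁, |quadExtension f x - quadExtension f y| ≤
      η₀ * (‖x‖ ^ 2 + ‖y‖ ^ 2) + C * ‖x - y‖ ^ 2)
    (hsmall : 5 * η₀ + C * θ ^ 2 ≤ ε / 2)
    (hnear : ∀ x : Fin k → H₂, (∀ i j, ‖⟪x i, x j⟫_ℂ - if i = j then 1 else 0‖ < η) →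
        ∃ w : Fin k → H₂, Orthonormal ℂ w ∧ ∀ i, ‖w i - x i‖ ≤ θ)
    (hn : 0 < finrank ℂ H₂)
    (hgram : (gaussianArray (Fin (finrank ℂ H₂)) (Fin k)).real
      {z | ∃ i j, η ≤ ‖(∑ q, starRingEnd ℂ (z q i) * z q j) / (finrank ℂ H₂ : ℂ) -
        if i = j then 1 else 0‖} ≤ C₀ / finrank ℂ H₂)
    (hC₀ : C₀ / finrank ℂ H₂ ≤ 1 / 2)
    (hK : (‖f‖ ^ 2 * ∫ z : Fin k → ℂ, (∑ i, ‖z i‖ ^ 2) ^ 2 ∂gaussianRow (Fin k)) / (ε / 2) ^ 2 /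
      finrank ℂ H₂ < δ / 2)
    (χ : OrthonormalBasis (Fin k) ℂ H₁) {p : Fin k → ℝ} (hp : ∀ i, 0 ≤ p i) (hp1 : ∑ i, p i = 1)
    {φ : Fin k → H₂} (hφ : Orthonormal ℂ φ) :
    1 - δ < (haarUnitary H₂).real {U | |∑ q, quadExtension f
      (∑ i, ⟪Unitary.linearIsometryEquiv U (stdOrthonormalBasis ℂ H₂ q), φ i⟫_ℂ •
        ((√(p i) : ℂ) • χ i)) -
      ∫ z, quadExtension f (∑ i, z i • ((√(p i) : ℂ) • χ i)) ∂gaussianRow (Fin k)| < ε} := by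
  set n := finrank ℂ H₂
  set e := stdOrthonormalBasis ℂ H₂
  set c : Fin k → H₁ := fun i => (√(p i) : ℂ) • χ i
  set I := ∫ z, quadExtension f (∑ i, z i • c i) ∂gaussianRow (Fin k)
  set A : Set (Fin n → Fin k → ℂ) := {z | ∃ i j, η ≤
    ‖(∑ q, starRingEnd ℂ (z q i) * z q j) / (n : ℂ) - if i = j then 1 else 0‖} with hA_def
  set B : Set (Fin n → Fin k → ℂ) := {z | ε / 2 ≤
    |(∑ q, quadExtension f (∑ i, z q i • c i)) / n - I|} with hB_def
  have hq := continuous_quadExtension f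
  have hA : MeasurableSet A := by
    have : A = ⋃ i, ⋃ j, {z | η ≤
        ‖(∑ q, starRingEnd ℂ (z q i) * z q j) / (n : ℂ) - if i = j then 1 else 0‖} := by
      ext z
      simp [hA_def]
    rw [this]
    refine MeasurableSet.iUnion fun i => MeasurableSet.iUnion fun j => ?_
    refine (isClosed_le continuous_const ?_).measurableSet
    have : Continuous fun z : Fin n → Fin k → ℂ => ∑ q, starRingEnd ℂ (z q i) * z q j := by
      refine continuous_finsetSum _ fun q _ => ?_
      exact (Complex.continuous_conj.comp (by fun_prop)).mul (by fun_prop)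
    fun_prop
  have hB : MeasurableSet B := by
    refine (isClosed_le continuous_const ?_).measurableSet
    fun_prop
  obtain ⟨z, hzA, hzB⟩ := exists_rotatedArray_notMem (H := H₂) hA hB (hgram.trans hC₀)
    ((gaussianArray_quadExtension_le f χ hp hp1 (half_pos hε) hn).trans_lt hK)
  have hn0 : (0 : ℝ) < n := Nat.cast_pos.2 hn
  have hs0 : 0 < (√n)⁻¹ := inv_pos.2 (Real.sqrt_pos.2 hn0)
  have hs2 : ((√n)⁻¹) ^ 2 = (n : ℝ)⁻¹ := by rw [inv_pow, Real.sq_sqrt hn0.le]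
  set x : Fin k → H₂ := fun i => (((√n)⁻¹ : ℝ) : ℂ) • ∑ r, z r i • e r with hx
  obtain ⟨w, hw, hwx⟩ := hnear x fun i j => by
    by_contra hcon
    refine hzA ⟨i, j, ?_⟩
    have hxx : ⟪x i, x j⟫_ℂ = (∑ q, starRingEnd ℂ (z q i) * z q j) / (n : ℂ) := by
      rw [hx, inner_smul_left, inner_smul_right, inner_sum_smul_stdOrthonormalBasis,
        Complex.conj_ofReal, ← mul_assoc, ← Complex.ofReal_mul, ← pow_two, hs2, div_eq_inv_mul]
      push_cast
      rfl
    rw [← hxx]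
    exact not_lt.1 hcon
  obtain ⟨V, hV⟩ := exists_unitary_apply_eq hφ hw
  set good : Set (unitary (H₂ →L[ℂ] H₂)) := {U | |∑ q, quadExtension f
      (∑ i, ⟪Unitary.linearIsometryEquiv U (e q), φ i⟫_ℂ • c i) - I| < ε} with hgood
  -- `⟨V⁻¹ U e q, φ i⟩ = ⟨U e q, V φ i⟩ = ⟨U e q, w i⟩`, so left invariance trades `φ` for `w`.
  have hinv : haarUnitary H₂ ((fun U => V⁻¹ * U) ⁻¹' good) = haarUnitary H₂ good :=
    measure_preimage_mul _ _ _
  have hmB : MeasurableSet {U : unitary (H₂ →L[ℂ] H₂) | rotatedArray U z ∈ B} := by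
    have : Continuous fun U : unitary (H₂ →L[ℂ] H₂) => rotatedArray U z :=
      continuous_rotatedArray.comp (by fun_prop : Continuous fun U => (z, U))
    exact this.measurable hB
  rw [measureReal_def, ← hinv, ← measureReal_def]
  refine lt_of_lt_of_le ?_ (measureReal_mono (s₁ := {U | rotatedArray U z ∈ B}ᶜ) ?_)
  · rw [probReal_compl_eq_one_sub hmB]
    linarith
  · intro U hU
    have hU' : |(∑ q, quadExtension f (∑ i, rotatedArray U z q i • c i)) / n - I| < ε / 2 :=
      not_le.1 hU
    set b := e.map (Unitary.linearIsometryEquiv U) with hb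
    -- By homogeneity of degree two, the `1 / n` of the mean becomes the factor `1 / √n` in `x`.
    have hbx : (∑ q, quadExtension f (∑ i, rotatedArray U z q i • c i)) / n =
        ∑ q, quadExtension f (∑ i, ⟪b q, x i⟫_ℂ • c i) := by
      rw [div_eq_inv_mul, Finset.mul_sum]
      refine Finset.sum_congr rfl fun q _ => ?_
      rw [← hs2, ← quadExtension_smul f hs0, Finset.smul_sum]
      simp_rw [hx, inner_smul_right, smul_smul]
      rfl
    have hbw (q) : ∑ i, ⟪b q, w i⟫_ℂ • c i =
        ∑ i, ⟪Unitary.linearIsometryEquiv (V⁻¹ * U) (e q), φ i⟫_ℂ • c i := by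
      refine Finset.sum_congr rfl fun i _ => ?_
      rw [← hV, ← LinearIsometryEquiv.inner_map_map (Unitary.linearIsometryEquiv V)
        (Unitary.linearIsometryEquiv (V⁻¹ * U) (e q)), map_mul, map_inv]
      simp [hb]
    have hcmp := abs_sum_quadExtension_sub_le f hη₀ hC hθ hf b χ hp hp1 hw.1 hwx
    rw [hbx] at hU'
    change |∑ q, quadExtension f
      (∑ i, ⟪Unitary.linearIsometryEquiv (V⁻¹ * U) (e q), φ i⟫_ℂ • c i) - I| < ε
    simp_rw [← hbw]
    refine (abs_sub_le _ (∑ q, quadExtension f (∑ i, ⟪b q, x i⟫_ℂ • c i)) _).trans_lt ?_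
    linarith

end Typicality

end GAPTypicality

theorem mainTheorem5 {H₁ : Type u} [NormedAddCommGroup H₁] [InnerProductSpace ℂ H₁]
    [FiniteDimensional ℂ H₁] [MeasurableSpace H₁] [BorelSpace H₁]
    (f : BoundedContinuousFunction (Metric.sphere (0 : H₁) 1) ℝ)
    (ε : ℝ) (hε : 0 < ε) (δ : ℝ) (hδ : 0 < δ) :
    ∃ M : ℕ, ∀ (H₂ : Type v) [NormedAddCommGroup H₂] [InnerProductSpace ℂ H₂]
      [FiniteDimensional ℂ H₂] [CompleteSpace H₂], M ≤ Module.finrank ℂ H₂ →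
      ∀ ψ : H₁ ⊗[ℂ] H₂, ‖ψ‖ = 1 →
        1 - δ < (GAPTypicality.uniformONB H₂).real
          {b | |(∫ φ, f φ ∂GAPTypicality.conditionalWaveLaw b ψ) -
              ∫ φ, f φ ∂GAPTypicality.gapMeasure (GAPTypicality.reducedDensity ψ)
                (GAPTypicality.reducedDensity_isPositive ψ)| < ε} := by
  open GAPTypicality in
  -- `5 · ε / 20` and `C * θ ^ 2 ≤ ε / 4` add up to the `ε / 2` allowed for orthonormalization; the
  -- other half goes to the law of large numbers.
  obtain ⟨C, hC, hf⟩ := exists_abs_quadExtension_sub_le f (η := ε / 20) (by positivity)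
  obtain ⟨θ, hθ0, hθ1, hθ⟩ : ∃ θ : ℝ, 0 < θ ∧ θ ≤ 1 ∧ C * θ ^ 2 ≤ ε / 4 := by
    refine ⟨min 1 (ε / (4 * (C + 1))), by positivity, min_le_left _ _, ?_⟩
    set θ := min 1 (ε / (4 * (C + 1)))
    have h0 : 0 ≤ θ := by positivity
    have h1 : θ ≤ 1 := min_le_left _ _
    have h2 : θ * (4 * (C + 1)) ≤ ε := (le_div_iff₀ (by positivity)).1 (min_le_right _ _)
    nlinarith [mul_nonneg hC h0, mul_nonneg (mul_nonneg hC h0) (sub_nonneg.2 h1)]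
  obtain ⟨η, hη, hnear⟩ := exists_orthonormal_near.{v} (finrank ℂ H₁) hθ0
  obtain ⟨C₀, hC₀⟩ := exists_gaussianArray_gram_le (Fin (finrank ℂ H₁)) hη
  have hlim (c : ℝ) : Filter.Tendsto (fun n : ℕ => c / n) Filter.atTop (nhds 0) :=
    tendsto_const_div_atTop_nhds_zero_nat c
  obtain ⟨M, hM⟩ := Filter.eventually_atTop.1 ((Filter.eventually_gt_atTop 0).and
    ((Filter.eventually_ge_atTop (finrank ℂ H₁)).and
    (((hlim C₀).eventually_lt_const (by norm_num : (0 : ℝ) < 1 / 2)).and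
    ((hlim ((‖f‖ ^ 2 * ∫ z : Fin (finrank ℂ H₁) → ℂ, (∑ i, ‖z i‖ ^ 2) ^ 2 ∂gaussianRow _) /
      (ε / 2) ^ 2)).eventually_lt_const (half_pos hδ)))))
  refine ⟨M, fun H₂ _ _ _ _ hH₂ ψ hψ => ?_⟩
  obtain ⟨hn, hk, h1, h2⟩ := hM _ hH₂
  obtain ⟨φ, hφ, hφψ⟩ := exists_schmidt hk ψ
  have hmain := one_sub_lt_haarUnitary f hε (by positivity) hC hθ1 hf (by linarith) (hnear H₂) hn
    (hC₀ _ hn) h1.le h2 ((reducedDensity_isPositive ψ).isSymmetric.eigenvectorBasis rfl)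
    ((reducedDensity_isPositive ψ).nonneg_eigenvalues rfl) (sum_eigenvalues_reducedDensity hψ)
    hφ
  refine hmain.trans_le (ENNReal.toReal_mono (measure_ne_top _ _) ?_)
  -- This inequality for image measures spares proving that the set of good bases is measurable.
  refine le_trans (le_of_eq ?_) (Measure.le_map_apply (measurable_map_onb _).aemeasurable _)
  congr 1
  ext U
  simp only [Set.mem_preimage, Set.mem_ofPred_eq]
  rw [integral_conditionalWaveLaw, integral_gapMeasure]
  simp_rw [hφψ]
  rfl
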